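/- **Setting.** Let $d\ge 1$, $T\ge 0$, $\mathcal X=[0,1)^d$, and let $\lambda_n$ be Lebesgue measure on $[0,1)^n$. Let $m_0$ be a probability measure on $\mathcal X$, $m_t$ ($t\ge1$) Markov kernels on $\mathcal X$, and $G_0:\mathcal X\to[0,\infty)$, $G_t:\mathcal X\times\mathcal X\to[0,\infty)$ potentials. With $(x_t)$ the Markov chain with initial law $m_0$ and kernels $m_t$, put $Z_t=\mathbb E[G_0(x_0)\prod_{s=1}^tG_s(x_{s-1},x_s)]$ and let $\mathbb Q_t(\varphi)=Z_t^{-1}\,\mathbb E[\varphi(x_t)G_0(x_0)\prod_{s=1}^tG_s(x_{s-1},x_s)]$. For measures on $[0,1)^n$ put $\|\mu-\nu\|_E=\sup_B|\mu(B)-\nu(B)|$, the supremum over boxes $B=\prod_{i=1}^n[a_i,b_i]$ with $0\le a_i<b_i<1$. Put $\mathcal S(x^{1:N})=N^{-1}\sum_{n=1}^N\delta_{x^n}$ and $D(u^{1:N})=\|\mathcal S(u^{1:N})-\lambda_n\|_E$. Let $H:[0,1]\to[0,1]^d$ be a Hilbert space-filling curve with $H(0)=0$: $H$ is continuous and, for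 every $m\ge0$, maps the $2^{md}$ consecutive closed intervals of length $2^{-md}$ of $[0,1]$ onto the $2^{md}$ closed dyadic cubes of side $2^{-m}$ of $[0,1]^d$, bijectively between intervals and cubes, the cubes of consecutive intervals being adjacent (they touch and, if $d\ge2$, share at least an edge). For $d=1$, $H$ is the identity. Let $h$ be a measurable pseudo-inverse: $H(h(x))=x$, with $h(\mathcal X)\subseteq[0,1)$. Let $\mathbb Q_{t,h}$ be the image of $\mathbb Q_t$ by $h$ and $m_{t,h}(s,dx)=m_t(H(s),dx)$. (This is needed only for $H(s)\in\mathcal X$, which holds for $\mathbb Q_{t-1,h}$-almost every $s$.) For a probability measure $\pi$ on $\mathcal X$ fix regular conditional distributions of $x_i$ given $x_{1:i-1}$; the Rosenblatt transform $F_\pi(x)$ has $i$-th coordinate the conditional distribution function of $x_i$ given $x_{1:i-1}$. Its inverse $F_\pi^{-1}(u)$ is computed coordinate by coordinate through the inverse distribution functions $\inf\{s\in[0,1):F(s)\ge u_i\}$. Write $F_{m_t}(x',\cdot)$ for the Rosenblatt transform of $m_t(x',dx)$, with the convention $F_{m_0}(x',x)=F_{m_0}(x)$. **Algorithm (SQMC).**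 For each $N$, let $u_0^{1:N}$ be a point set in $[0,1)^d$ and, for $t\in\{1,\dots,T\}$, $u_t^{1:N}$ a point set in $[0,1)^{d+1}$, $u_t^n=(w_t^n,v_t^n)$ with $w_t^n\in[0,1)$, $v_t^n\in[0,1)^d$, labelled so that $w_t^1\le\dots\le w_t^N$. (The points may depend on $N$ in any way.) Put $x_0^n=F_{m_0}^{-1}(u_0^n)$ and $W_0^n=G_0(x_0^n)/\sum_kG_0(x_0^k)$. For $t=1,\dots,T$: let $\sigma$ be a permutation with $h(x_{t-1}^{\sigma(1)})\le\dots\le h(x_{t-1}^{\sigma(N)})$; put $\hat x_{t-1}^n=x_{t-1}^{\sigma(k)}$ with $k=\min\{k:\sum_{i\le k}W_{t-1}^{\sigma(i)}\ge w_t^n\}$; put $x_t^n=F_{m_t}^{-1}(\hat x_{t-1}^n,v_t^n)$ and $W_t^n=G_t(\hat x_{t-1}^n,x_t^n)/\sum_kG_t(\hat x_{t-1}^k,x_t^k)$. Let $\hat{\mathbb Q}_t^N=\sum_{n=1}^NW_t^n\delta_{x_t^n}$. **Theorem.** Suppose that $D(u_t^{1:N})\to0$ as $N\to\infty$ for every $t\in\{0,\dots,T\}$,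 and that for every $t\in\{0,\dots,T\}$: 1. the particles $x_t^1,\dots,x_t^N$ are pairwise distinct (for every $N$); 2. $G_t$ is continuous and bounded; 3. (a) for every $i$ and every fixed $x'$, the $i$-th coordinate of $F_{m_t}(x',x)$ is strictly increasing in $x_i\in[0,1)$; (b) $(x',x)\mapsto F_{m_t}(x',x)$ is Hölder continuous; (c) for every $i$, the conditional distribution of $x_i$ given $x_{1:i-1}$ relative to $m_t(x',dx)$ has a Lebesgue density $p_{ti}(x_i\mid x_{1:i-1},x')$ with $\|p_{ti}(\cdot\mid\cdot)\|_\infty<\infty$; 4. $\mathbb Q_t(dx)=p_t(x)\lambda_d(dx)$ with $p_t$ a strictly positive bounded density. Then, with $P_{t,h}^N=\big(h(\hat x_{t-1}^n),x_t^n\big)_{n=1}^N$ in $[0,1)^{1+d}$, $$\big\|\mathcal S(P_{t,h}^N)-\mathbb Q_{t-1,h}\otimes m_{t,h}\big\|_E\to0\quad(N\to\infty)\qquad\text{for every }t\in\{1,\dots,T\},$$ $$\big\|\hat{\mathbb Q}_t^N-\mathbb Q_t\big\|_E\to0\quad(N\to\infty)\qquad\text{for every }t\in\{0,\dots,T\}.$$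 -/

import Mathlib

open Set Filter Topology MeasureTheory ProbabilityTheory
open scoped NNReal ENNReal

noncomputable section

/-! ### The cube, the extreme norm, empirical measures -/

/-- The half-open unit interval `[0,1)`. -/
abbrev UI : Type := Set.Ico (0 : ℝ) 1

/-- The half-open unit cube `[0,1)^n`. -/
abbrev Cube (n : ℕ) : Type := Fin n → UI

/-- Lebesgue measure on `[0,1)`. -/
def lebUI : Measure UI := (volume : Measure ℝ).comap Subtype.val

/-- Lebesgue measure on `[0,1)^n`. -/
def lebCube (n : ℕ) : Measure (Cube n) := Measure.pi (fun _ => lebUI)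

/-- The origin of `[0,1)`. -/
def uiZero : UI := ⟨0, le_refl 0, zero_lt_one⟩

/-- A real number in `[0,1)` as an element of `UI` (the value elsewhere is irrelevant). -/
def toUI (r : ℝ) : UI :=
  open Classical in if hr : r ∈ Set.Ico (0 : ℝ) 1 then ⟨r, hr⟩ else uiZero

theorem measurable_toUI : Measurable toUI := by
  classical
  have h : Measurable (fun r : ℝ => if r ∈ Set.Ico (0 : ℝ) 1 then r else 0) :=
    Measurable.ite measurableSet_Ico measurable_id measurable_const
  have h2 : (fun r : ℝ => ((toUI r : UI) : ℝ)) =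
      fun r : ℝ => if r ∈ Set.Ico (0 : ℝ) 1 then r else 0 := by
    funext r
    by_cases hr : r ∈ Set.Ico (0 : ℝ) 1
    · simp only [toUI, dif_pos hr, if_pos hr]
    · simp only [toUI, dif_neg hr, if_neg hr, uiZero]
  have h3 : Measurable (fun r : ℝ => ((toUI r : UI) : ℝ)) := by
    rw [h2]
    exact h
  exact h3.subtype_mk (h := fun r => (toUI r).2)

/-- The extreme norm `sup_B |μ(B) - ν(B)|` over the boxes
`B = ∏ᵢ [aᵢ, bᵢ]` with `0 ≤ aᵢ < bᵢ < 1`. -/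
def extremeNorm {n : ℕ} (μ ν : Measure (Cube n)) : ℝ :=
  sSup {r : ℝ | ∃ a b : Cube n, (∀ i, a i < b i) ∧
    r = |μ.real (Set.Icc a b) - ν.real (Set.Icc a b)|}

/-- The empirical measure `N⁻¹ ∑ₙ δ_{xⁿ}` of a point set. -/
def empirical {n N : ℕ} (x : Fin N → Cube n) : Measure (Cube n) :=
  (N : ℝ≥0∞)⁻¹ • ∑ k, Measure.dirac (x k)

/-- The extreme discrepancy of a point set in `[0,1)^n`. -/
def discrepancy {n N : ℕ} (u : Fin N → Cube n) : ℝ :=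
  extremeNorm (empirical u) (lebCube n)

/-! ### Hilbert curves -/

/-- The inclusion of `[0,1)` in `[0,1]`. -/
def inclUI (s : UI) : unitInterval := ⟨s, s.2.1, s.2.2.le⟩

/-- The inclusion of `[0,1)^d` in `[0,1]^d`. -/
def inclCube {d : ℕ} (x : Cube d) : Fin d → unitInterval := fun i => inclUI (x i)

/-- A point of `[0,1]^d` that lies in `[0,1)^d`, as a point of `[0,1)^d` (the value at the other
points is irrelevant). -/
def toCube {d : ℕ} (x : Fin d → unitInterval) : Cube d := fun i => toUI (x i)

/-- The closed interval `[k 2^{-md}, (k+1) 2^{-md}]`. -/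
def hilbertInterval (d m : ℕ) (k : Fin (2 ^ (m * d))) : Set unitInterval :=
  {s | (k : ℝ) / 2 ^ (m * d) ≤ s ∧ (s : ℝ) ≤ ((k : ℝ) + 1) / 2 ^ (m * d)}

/-- The closed dyadic cube `∏ᵢ [cᵢ 2^{-m}, (cᵢ+1) 2^{-m}]`. -/
def dyadicCube {d : ℕ} (m : ℕ) (c : Fin d → Fin (2 ^ m)) : Set (Fin d → unitInterval) :=
  {x | ∀ i, (c i : ℝ) / 2 ^ m ≤ x i ∧ (x i : ℝ) ≤ ((c i : ℝ) + 1) / 2 ^ m}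

/-- Two dyadic cubes of the same size touch and, when `d ≥ 2`, have at least an edge in common. -/
def CellsAdjacent {d m : ℕ} (c c' : Fin d → Fin (2 ^ m)) : Prop :=
  (∀ i, (c i : ℕ) ≤ c' i + 1 ∧ (c' i : ℕ) ≤ c i + 1) ∧ (2 ≤ d → ∃ i, c i = c' i)

/-- `H : [0,1] → [0,1]^d` is a Hilbert space-filling curve starting at the origin: for each level
`m`, `H` maps the `2^{md}` consecutive intervals of length `2^{-md}` onto the `2^{md}` dyadic cubes
of side `2^{-m}`, each cube being the image of exactly one of the intervals, and the images of
consecutive intervals are adjacent. The nesting property (the `2^d` subintervals of a level-`m`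
interval fill the `2^d` subcubes of its cube) is a consequence, since all the levels concern the
same map `H`. The curve is not unique; for `d = 1` only the identity map qualifies. -/
structure IsHilbertCurve {d : ℕ} (H : C(unitInterval, Fin d → unitInterval)) : Prop where
  zero : H 0 = 0
  cells : ∀ m : ℕ, ∃ S : Fin (2 ^ (m * d)) → (Fin d → Fin (2 ^ m)),
    Function.Bijective S ∧
    (∀ k, H '' hilbertInterval d m k = dyadicCube m (S k)) ∧
    (∀ k l : Fin (2 ^ (m * d)), (k : ℕ) + 1 = l → CellsAdjacent (S k) (S l))

/-- `h` is (the restriction to `[0,1)^d` of) a Borel pseudo-inverse of `H`, so `H (h x) = x`; it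
takes `[0,1)^d` into `[0,1)`. -/
structure IsHilbertPseudoInverse {d : ℕ} (H : C(unitInterval, Fin d → unitInterval))
    (h : Cube d → UI) : Prop where
  measurable : Measurable h
  right_inv : ∀ x, H (inclUI (h x)) = inclCube x

theorem measurable_toCube_hilbert {d : ℕ} (H : C(unitInterval, Fin d → unitInterval)) :
    Measurable (fun s : UI => toCube (H (inclUI s))) := by
  refine measurable_pi_lambda _ fun i => ?_
  have hincl : Continuous inclUI := Continuous.subtype_mk continuous_subtype_val _
  have hc : Continuous (fun s : UI => ((H (inclUI s) i : unitInterval) : ℝ)) :=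
    continuous_subtype_val.comp ((continuous_apply i).comp (H.continuous.comp hincl))
  exact measurable_toUI.comp hc.measurable

/-- The kernel `K_h(s, dx) = K(H(s), dx)` from `[0,1)` to `[0,1)^d`. -/
def hilbertKernel {d : ℕ} (H : C(unitInterval, Fin d → unitInterval))
    (K : Kernel (Cube d) (Cube d)) : Kernel UI (Cube d) :=
  K.comap (fun s : UI => toCube (H (inclUI s))) (measurable_toCube_hilbert H)

/-! ### Rosenblatt transforms -/

/-- The first coordinates `x_{1:i-1}` of a point. -/
abbrev InitialCoords {d : ℕ} (i : Fin d) : Type := {j : Fin d // j < i} → UI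

/-- `x_{1:i-1}`. -/
def initialCoords {d : ℕ} (i : Fin d) (x : Cube d) : InitialCoords i := fun j => x j

/-- Candidates for the conditional distributions `πᵢ(x_{1:i-1}, dxᵢ)`, `i = 1, …, d`. -/
abbrev CondFamily (d : ℕ) : Type := (i : Fin d) → Kernel (InitialCoords i) UI

/-- `κ i` is a regular conditional distribution of the component `xᵢ` given `x_{1:i-1}` relative
to `π`, for every `i`. -/
def IsConditionalFamily {d : ℕ} (π : Measure (Cube d)) (κ : CondFamily d) : Prop :=
  ∀ i, IsMarkovKernel (κ i) ∧
    π.map (fun x => (initialCoords i x, x i)) = (π.map (initialCoords i)) ⊗ₘ (κ i)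

/-- The Rosenblatt transform: its `i`-th coordinate is the conditional distribution function
`F_{π,i}(xᵢ | x_{1:i-1})`. -/
def rosenblatt {d : ℕ} (κ : CondFamily d) (x : Cube d) : Fin d → ℝ :=
  fun i => (κ i (initialCoords i x)).real (Set.Iic (x i))

/-- The inverse distribution function `inf {x ∈ [0,1) : F(x) ≥ u}` on `[0,1)`. -/
def quantile (μ : Measure UI) (u : UI) : UI :=
  toUI (sInf {r : ℝ | ∃ x : UI, (x : ℝ) = r ∧ (u : ℝ) ≤ μ.real (Set.Iic x)})

/-- The inverse Rosenblatt transform: `xᵢ` is obtained from `uᵢ` by the inverse distribution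
function of the conditional distribution given the already computed `x_{1:i-1}`. -/
def rosenblattInv {d : ℕ} (κ : CondFamily d) (u : Cube d) (i : Fin d) : UI :=
  quantile (κ i (fun j => rosenblattInv κ u j.1)) (u i)
termination_by i.val
decreasing_by exact j.2

/-- The regularity required of the Rosenblatt transforms `F(x', x)` of a family of distributions
with conditional distributions `κ x'`. -/
structure RosenblattRegular {d : ℕ} (κ : Cube d → CondFamily d) : Prop where
  strictMono : ∀ (i : Fin d) (x' x : Cube d),
    StrictMono (fun s : UI => rosenblatt (κ x') (Function.update x i s) i)
  holder : ∃ C r : ℝ≥0, 0 < r ∧ r ≤ 1 ∧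
    HolderWith C r (fun p : Cube d × Cube d => rosenblatt (κ p.1) p.2)
  bounded_density : ∀ i : Fin d, ∃ p : Cube d → InitialCoords i → UI → ℝ≥0,
    (∃ C : ℝ≥0, ∀ x' y s, p x' y s ≤ C) ∧
    ∀ x' y, Measurable (p x' y) ∧
      κ x' i y = lebUI.withDensity (fun s => (p x' y s : ℝ≥0∞))

/-! ### Feynman-Kac models -/

/-- A Feynman-Kac model on `[0,1)^d`: initial distribution `m₀`, transition kernels `m_t`, potentials
`G₀` and `G_t`. The entries `m 0` and `G 0` are not used. -/
structure FeynmanKac (d : ℕ) where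
  m₀ : Measure (Cube d)
  m : ℕ → Kernel (Cube d) (Cube d)
  G₀ : Cube d → ℝ≥0
  G : ℕ → Cube d → Cube d → ℝ≥0
  isProbabilityMeasure_m₀ : IsProbabilityMeasure m₀
  isMarkovKernel_m : ∀ t, IsMarkovKernel (m t)

namespace FeynmanKac

variable {d : ℕ} (M : FeynmanKac d)

/-- The law of `(x_0, …, x_t)` for the Markov chain with initial law `m₀` and kernels `m_t`. -/
def pathLaw : (t : ℕ) → Measure (Fin (t + 1) → Cube d)
  | 0 => M.m₀.map (fun x _ => x)
  | t + 1 =>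
    (pathLaw t ⊗ₘ (M.m (t + 1)).comap (fun z => z (Fin.last t)) (measurable_pi_apply _)).map
      (fun p => Fin.snoc p.1 p.2)

/-- `G₀(x_0) ∏_{s=1}^t G_s(x_{s-1}, x_s)`. -/
def pathPotential (t : ℕ) (z : Fin (t + 1) → Cube d) : ℝ≥0 :=
  M.G₀ (z 0) * ∏ s : Fin t, M.G (s + 1) (z s.castSucc) (z s.succ)

/-- The normalising constant `Z_t`. -/
def Z (t : ℕ) : ℝ≥0∞ := ∫⁻ z, (M.pathPotential t z : ℝ≥0∞) ∂(M.pathLaw t)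

/-- The filtering distribution
`Q_t(φ) = Z_t⁻¹ E[φ(x_t) G₀(x_0) ∏_{s=1}^t G_s(x_{s-1}, x_s)]`. -/
def Q (t : ℕ) : Measure (Cube d) :=
  (M.Z t)⁻¹ • ((M.pathLaw t).withDensity (fun z => (M.pathPotential t z : ℝ≥0∞))).map
    (fun z => z (Fin.last t))

end FeynmanKac

/-! ### Sequential quasi-Monte Carlo -/

/-- Normalised weights. -/
def normalizeWeights {N : ℕ} (w : Fin N → ℝ≥0) : Fin N → ℝ≥0 := fun n => w n / ∑ k, w k

/-- A weighted particle system `(xⁿ, Wⁿ)`, `n = 1, …, N`. -/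
structure Particles (d N : ℕ) where
  x : Fin N → Cube d
  W : Fin N → ℝ≥0

namespace Particles

variable {d N : ℕ}

/-- The weighted empirical measure `∑ₙ Wⁿ δ_{xⁿ}`. -/
def measure (P : Particles d N) : Measure (Cube d) :=
  ∑ n, P.W n • Measure.dirac (P.x n)

/-- The Hilbert sort: a permutation `σ` such that `h(x^{σ(1)}) ≤ … ≤ h(x^{σ(N)})`. -/
def hilbertSort (h : Cube d → UI) (P : Particles d N) : Equiv.Perm (Fin N) :=
  Tuple.sort (fun n => h (P.x n))

/-- The distribution function `F(k) = ∑_{i ≤ k} W^{σ(i)}` of the Hilbert-sorted weights. -/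
def sortedCDF (h : Cube d → UI) (P : Particles d N) (k : Fin N) : ℝ≥0 :=
  ∑ i ∈ Finset.Iic k, P.W (P.hilbertSort h i)

/-- The resampled points `x̂ⁿ = x^{σ(k)}`, where `k = min {k : F(k) ≥ uⁿ}` (the minimum exists as
soon as the weights add up to one; otherwise `k` is set to `n`). -/
def resample (h : Cube d → UI) (P : Particles d N) (u : Fin N → UI) : Fin N → Cube d :=
  fun n => P.x (P.hilbertSort h
    ((Finset.univ.filter (fun k => (u n : ℝ) ≤ P.sortedCDF h k)).min.untopD n))

end Particles

/-- The SQMC algorithm with `N` particles, started from the point set `u₀` in `[0,1)^d` and using at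
time `t ≥ 1` the point set `u t` in `[0,1)^{d+1}`, whose first coordinates drive the resampling
and whose last `d` coordinates drive the mutation. `κ₀` and `κ t x'` are the conditional
distributions that define the Rosenblatt transforms of `m₀` and `m_t(x', ·)`. -/
def sqmc {d N : ℕ} (M : FeynmanKac d) (h : Cube d → UI)
    (κ₀ : CondFamily d) (κ : ℕ → Cube d → CondFamily d)
    (u₀ : Fin N → Cube d) (u : ℕ → Fin N → Cube (d + 1)) : ℕ → Particles d N
  | 0 =>
    let x : Fin N → Cube d := fun n => rosenblattInv κ₀ (u₀ n)
    { x := x, W := normalizeWeights (fun n => M.G₀ (x n)) }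
  | t + 1 =>
    let xhat : Fin N → Cube d :=
      (sqmc M h κ₀ κ u₀ u t).resample h (fun n => u (t + 1) n 0)
    let x : Fin N → Cube d :=
      fun n => rosenblattInv (κ (t + 1) (xhat n)) (Fin.tail (u (t + 1) n))
    { x := x, W := normalizeWeights (fun n => M.G (t + 1) (xhat n) (x n)) }

/-- The resampled points `x̂_t^{1:N}` of the SQMC algorithm that are moved at time `t + 1`. -/
def sqmcHat {d N : ℕ} (M : FeynmanKac d) (h : Cube d → UI)
    (κ₀ : CondFamily d) (κ : ℕ → Cube d → CondFamily d)
    (u₀ : Fin N → Cube d) (u : ℕ → Fin N → Cube (d + 1)) (t : ℕ) : Fin N → Cube d :=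
  (sqmc M h κ₀ κ u₀ u t).resample h (fun n => u (t + 1) n 0)

/-- The point `(s, x)` of `[0,1)^{1+d}`. -/
def joinPoint {d : ℕ} (p : UI × Cube d) : Cube (d + 1) := Fin.cons p.1 p.2

end

/-! The extreme norm is exchanged for weak convergence at both ends. Discrepancy tending to zero
means that the empirical measures converge weakly to Lebesgue measure (`weakLim_of_discrepancy`).
Conversely, weak convergence to a law that charges no axis-parallel hyperplane is uniform over boxes
(`WeakLim.tendsto_extremeNorm`). In between, weak convergence of the weighted particle measures to
`M.Q t` is proved by induction on `t`.

In one step of the algorithm, the pair (resampled point, new particle) is the image of a single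
point of `u N (t + 1)` under a map `T_N` depending on the current weighted particles. An average
over particles is therefore the integral of `ψ ∘ T_N` against an empirical measure, and integrand
and measure both vary with `N`. The extended continuous mapping theorem `WeakLim.tendsto_integral`
handles this, provided that `T_N(v_N) → T(v)` whenever `v_N → v`, for almost every `v`.

This continuous convergence holds for the following reasons. A pseudo-inverse `h` is continuous off
the dyadic hyperplanes, so the weighted distribution functions along the Hilbert axis converge. The
limit law `(M.Q t).map h` has no atoms and a strictly increasing distribution function, because `h`
is injective and every dyadic cell has positive mass; hence the generalised inverses used for
resampling converge to its quantile function (`tendsto_resampleAt`). The resampled points then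
converge because `H` is continuous and `H (h x) = x`, and the new particles converge because the
inverse Rosenblatt transform is jointly continuous (`continuous_rosenblattInv`).

The limit map `T` sends Lebesgue measure to `(M.Q t).map h ⊗ₘ hilbertKernel H (M.m (t + 1))`, which
gives the first claim. Reweighting by the bounded continuous potential and normalising turns this
limit into `M.Q (t + 1)` (`FeynmanKac.Q_succ`), which closes the induction. -/

/-! ### Weak convergence of finite measures -/

/-- Weak convergence of a sequence of measures. -/
def WeakLim {X : Type*} [TopologicalSpace X] [MeasurableSpace X] (μs : ℕ → Measure X)
    (μ : Measure X) : Prop :=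
  ∀ f : X → ℝ, Continuous f → (∃ C, ∀ x, |f x| ≤ C) →
    Tendsto (fun N => ∫ x, f x ∂μs N) atTop (𝓝 (∫ x, f x ∂μ))

theorem integrable_of_abs_le {X : Type*} [MeasurableSpace X] {μ : Measure X} [IsFiniteMeasure μ]
    {f : X → ℝ} (hf : AEStronglyMeasurable f μ) {C : ℝ} (hC : ∀ x, |f x| ≤ C) :
    Integrable f μ :=
  Integrable.of_bound hf C (Eventually.of_forall hC)

/-- Lipschitz functions `φ k` that dominate `f N` for `k ≤ N` and converge wherever `f` converges
continuously. -/
theorem exists_lipschitz_majorants {X : Type*} [PseudoMetricSpace X] {f : ℕ → X → ℝ} {C : ℝ}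
    (hC : ∀ N x, |f N x| ≤ C) :
    ∃ φ : ℕ → X → ℝ, (∀ k, Continuous (φ k)) ∧ (∀ k x, |φ k x| ≤ C) ∧
      (∀ k N x, k ≤ N → f N x ≤ φ k x) ∧
      ∀ (x : X) (c : ℝ), Tendsto (fun p : ℕ × X => f p.1 p.2) (atTop ×ˢ 𝓝 x) (𝓝 c) →
        Tendsto (fun k => φ k x) atTop (𝓝 c) := by
  -- Sup-convolution of the tail `f N`, `N ≥ k`, with the cone of slope `k`: a supremum of
  -- `k`-Lipschitz functions of `x`.
  let φ : ℕ → X → ℝ := fun k x =>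
    ⨆ p : {N : ℕ // k ≤ N} × X, (f p.1 p.2 - k * dist x p.2)
  have hle : ∀ k x (p : {N : ℕ // k ≤ N} × X), f p.1 p.2 - k * dist x p.2 ≤ C := fun k x p => by
    have h1 := (abs_le.1 (hC p.1 p.2)).2
    have h2 : 0 ≤ (k : ℝ) * dist x p.2 := by positivity
    linarith
  have hbdd : ∀ k x, BddAbove (range fun p : {N : ℕ // k ≤ N} × X =>
      (f p.1 p.2 - k * dist x p.2)) := fun k x => ⟨C, by rintro _ ⟨p, rfl⟩; exact hle k x p⟩
  have hmaj : ∀ k N x, k ≤ N → f N x ≤ φ k x := fun k N x hk => by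
    have := le_ciSup (hbdd k x) (⟨⟨N, hk⟩, x⟩ : {N : ℕ // k ≤ N} × X)
    simpa using this
  have hne : ∀ k (x : X), Nonempty ({N : ℕ // k ≤ N} × X) := fun k x => ⟨⟨⟨k, le_rfl⟩, x⟩⟩
  refine ⟨φ, fun k => ?_, fun k x => ?_, hmaj, fun x c hx => ?_⟩
  · refine (LipschitzWith.of_le_add_mul (k : ℝ≥0) fun x y => ?_).continuous
    have := hne k x
    refine ciSup_le fun p => ?_
    have h1 := le_ciSup (hbdd k y) p
    have h2 : dist y p.2 ≤ dist x y + dist x p.2 := dist_triangle_left _ _ _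
    have h3 : (k : ℝ) * dist y p.2 ≤ k * (dist x y + dist x p.2) :=
      mul_le_mul_of_nonneg_left h2 (Nat.cast_nonneg k)
    have h4 : f p.1 p.2 - k * dist y p.2 ≤ φ k y := h1
    simp only [NNReal.coe_natCast]
    linarith
  · have := hne k x
    exact abs_le.2 ⟨(abs_le.1 (hC k x)).1.trans (hmaj k k x le_rfl), ciSup_le fun p => hle k x p⟩
  · rw [Metric.tendsto_atTop]
    intro ε hε
    have h1 := (Metric.tendsto_nhds.1 hx) (ε / 2) (half_pos hε)
    obtain ⟨s, hs, t, ht, hst⟩ := Filter.mem_prod_iff.1 h1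
    obtain ⟨k0, hk0⟩ := mem_atTop_sets.1 hs
    obtain ⟨δ, hδ, hball⟩ := Metric.mem_nhds_iff.1 ht
    -- For `k ≥ k1` the penalty at distance at least `δ` is at least `C - c`, so far points
    -- contribute at most `c` to the supremum.
    obtain ⟨k1, hk1⟩ := exists_nat_ge ((C - c) / δ)
    refine ⟨max k0 k1, fun k hk => ?_⟩
    have := hne k x
    have hup : φ k x ≤ c + ε / 2 := by
      refine ciSup_le fun p => ?_
      rcases lt_or_ge (dist p.2 x) δ with hd | hd
      · have h2 : ((p.1 : ℕ), p.2) ∈ s ×ˢ t :=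
          ⟨hk0 _ (((le_max_left _ _).trans hk).trans p.1.2), hball hd⟩
        have h3 : |f p.1 p.2 - c| < ε / 2 := hst h2
        have h4 : 0 ≤ (k : ℝ) * dist x p.2 := by positivity
        linarith [(abs_lt.1 h3).2]
      · have h2 : (k1 : ℝ) ≤ k := by exact_mod_cast (le_max_right _ _).trans hk
        have h3 : C - c ≤ k * δ := (div_le_iff₀ hδ).1 (hk1.trans h2)
        have h4 : (k : ℝ) * δ ≤ k * dist x p.2 := by
          rw [dist_comm] at hd
          exact mul_le_mul_of_nonneg_left hd (Nat.cast_nonneg k)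
        linarith [(abs_le.1 (hC p.1 p.2)).2]
    have hlow : c - ε / 2 ≤ φ k x := by
      have h2 : (k, x) ∈ s ×ˢ t :=
        ⟨hk0 _ ((le_max_left _ _).trans hk), hball (Metric.mem_ball_self hδ)⟩
      have h3 : |f k x - c| < ε / 2 := hst h2
      linarith [(abs_lt.1 h3).1, hmaj k k x le_rfl]
    rw [Real.dist_eq, abs_lt]
    constructor <;> linarith

/-- A fixed majorant `φ k` dominates every `f N` with `N ≥ k`, and weak convergence applies to it.
Its limit integral is close to that of `g` for large `k`, by dominated convergence. -/
theorem WeakLim.eventually_integral_lt {X : Type*} [PseudoMetricSpace X] [MeasurableSpace X]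
    [BorelSpace X] {μs : ℕ → Measure X} {μ : Measure X} [∀ N, IsFiniteMeasure (μs N)]
    [IsFiniteMeasure μ] (hμ : WeakLim μs μ) {f : ℕ → X → ℝ} {g : X → ℝ} {C : ℝ}
    (hf : ∀ N, AEStronglyMeasurable (f N) (μs N)) (hC : ∀ N x, |f N x| ≤ C)
    (hlim : ∀ᵐ x ∂μ, Tendsto (fun p : ℕ × X => f p.1 p.2) (atTop ×ˢ 𝓝 x) (𝓝 (g x)))
    {c : ℝ} (hc : ∫ x, g x ∂μ < c) : ∀ᶠ N in atTop, ∫ x, f N x ∂μs N < c := by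
  obtain ⟨φ, hφc, hφC, hmaj, hφ⟩ := exists_lipschitz_majorants hC
  have h1 : Tendsto (fun k => ∫ x, φ k x ∂μ) atTop (𝓝 (∫ x, g x ∂μ)) :=
    tendsto_integral_of_dominated_convergence (fun _ => C)
      (fun k => (hφc k).measurable.aestronglyMeasurable) (integrable_const C)
      (fun k => Eventually.of_forall (hφC k)) (hlim.mono fun x hx => hφ x _ hx)
  obtain ⟨k, hk⟩ := (h1.eventually_lt_const hc).exists
  filter_upwards [(hμ (φ k) (hφc k) ⟨C, hφC k⟩).eventually_lt_const hk, eventually_ge_atTop k]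
    with N hN hkN
  refine lt_of_le_of_lt (integral_mono (integrable_of_abs_le (hf N) (hC N))
    (integrable_of_abs_le (hφc k).measurable.aestronglyMeasurable (hφC k))
    fun x => hmaj k N x hkN) hN

/-- Extended continuous mapping theorem: integrals of uniformly bounded functions that converge
continuously almost everywhere for the limit. -/
theorem WeakLim.tendsto_integral {X : Type*} [PseudoMetricSpace X] [MeasurableSpace X]
    [BorelSpace X] {μs : ℕ → Measure X} {μ : Measure X} [∀ N, IsFiniteMeasure (μs N)]
    [IsFiniteMeasure μ] (hμ : WeakLim μs μ) {f : ℕ → X → ℝ} {g : X → ℝ} {C : ℝ}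
    (hf : ∀ N, AEStronglyMeasurable (f N) (μs N)) (hC : ∀ N x, |f N x| ≤ C)
    (hlim : ∀ᵐ x ∂μ, Tendsto (fun p : ℕ × X => f p.1 p.2) (atTop ×ˢ 𝓝 x) (𝓝 (g x))) :
    Tendsto (fun N => ∫ x, f N x ∂μs N) atTop (𝓝 (∫ x, g x ∂μ)) := by
  rw [tendsto_order]
  refine ⟨fun c hc => ?_, fun c hc => hμ.eventually_integral_lt hf hC hlim hc⟩
  have := hμ.eventually_integral_lt (f := fun N x => -f N x) (g := fun x => -g x) (c := -c)
    (fun N => (hf N).neg) (fun N x => by rw [abs_neg]; exact hC N x)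
    (hlim.mono fun x hx => hx.neg) (by rw [integral_neg]; linarith)
  filter_upwards [this] with N hN
  rw [integral_neg] at hN
  linarith

theorem WeakLim.const {X : Type*} [TopologicalSpace X] [MeasurableSpace X] (μ : Measure X) :
    WeakLim (fun _ => μ) μ := fun _ _ _ => tendsto_const_nhds

theorem WeakLim.comp {X : Type*} [TopologicalSpace X] [MeasurableSpace X] {μs : ℕ → Measure X}
    {μ : Measure X} (hμ : WeakLim μs μ) {ψ : ℕ → ℕ} (hψ : Tendsto ψ atTop atTop) :
    WeakLim (fun N => μs (ψ N)) μ := fun f hf hC => (hμ f hf hC).comp hψ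

/-- Continuity points of the indicators of converging boxes. -/
theorem tendsto_indicator_box {n : ℕ} {a b : ℕ → Cube n} {a' b' : Fin n → ℝ}
    (ha : Tendsto (fun N i => (a N i : ℝ)) atTop (𝓝 a'))
    (hb : Tendsto (fun N i => (b N i : ℝ)) atTop (𝓝 b'))
    {x : Cube n} (hxa : ∀ i, (x i : ℝ) ≠ a' i) (hxb : ∀ i, (x i : ℝ) ≠ b' i) :
    Tendsto (fun p : ℕ × Cube n => (Icc (a p.1) (b p.1)).indicator (fun _ => (1 : ℝ)) p.2)
      (atTop ×ˢ 𝓝 x)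
      (𝓝 ({y : Cube n | ∀ i, a' i ≤ y i ∧ (y i : ℝ) ≤ b' i}.indicator (fun _ => (1 : ℝ)) x)) := by
  have hx : ∀ i, Tendsto (fun p : ℕ × Cube n => ((p.2 i : UI) : ℝ)) (atTop ×ˢ 𝓝 x)
      (𝓝 (x i : ℝ)) := fun i =>
    ((continuous_subtype_val.comp (continuous_apply i)).tendsto x).comp tendsto_snd
  have ha2 : ∀ i, Tendsto (fun p : ℕ × Cube n => ((a p.1 i : UI) : ℝ)) (atTop ×ˢ 𝓝 x)
      (𝓝 (a' i)) := fun i => ((tendsto_pi_nhds.1 ha i)).comp tendsto_fst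
  have hb2 : ∀ i, Tendsto (fun p : ℕ × Cube n => ((b p.1 i : UI) : ℝ)) (atTop ×ˢ 𝓝 x)
      (𝓝 (b' i)) := fun i => ((tendsto_pi_nhds.1 hb i)).comp tendsto_fst
  by_cases hin : ∀ i, a' i ≤ x i ∧ (x i : ℝ) ≤ b' i
  · rw [indicator_of_mem (show x ∈ {y : Cube n | ∀ i, a' i ≤ y i ∧ (y i : ℝ) ≤ b' i} from hin)]
    refine tendsto_const_nhds.congr' ?_
    have h1 : ∀ᶠ p : ℕ × Cube n in atTop ×ˢ 𝓝 x, ∀ i,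
        ((a p.1 i : UI) : ℝ) < (p.2 i : UI) ∧ ((p.2 i : UI) : ℝ) < (b p.1 i : UI) := by
      refine eventually_all.2 fun i => ?_
      exact ((ha2 i).eventually_lt (hx i) (lt_of_le_of_ne (hin i).1 (hxa i).symm)).and
        ((hx i).eventually_lt (hb2 i) (lt_of_le_of_ne (hin i).2 (hxb i)))
    filter_upwards [h1] with p hp
    rw [indicator_of_mem]
    exact ⟨fun i => (hp i).1.le, fun i => (hp i).2.le⟩
  · rw [indicator_of_notMem
      (show x ∉ {y : Cube n | ∀ i, a' i ≤ y i ∧ (y i : ℝ) ≤ b' i} from hin)]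
    refine tendsto_const_nhds.congr' ?_
    push Not at hin
    obtain ⟨i, hi⟩ := hin
    by_cases hlt : (x i : ℝ) < a' i
    · filter_upwards [(hx i).eventually_lt (ha2 i) hlt] with p hp
      rw [indicator_of_notMem]
      exact fun h => absurd (h.1 i) (not_le.2 hp)
    · filter_upwards [(hb2 i).eventually_lt (hx i) (hi (not_lt.1 hlt))] with p hp
      rw [indicator_of_notMem]
      exact fun h => absurd (h.2 i) (not_le.2 hp)

/-- The continuous mapping theorem, applied to `μs` and to the constant sequence `μ`, gives the same
limit, which cancels. The limiting corners are real vectors because a coordinate may tend to `1`,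
outside the half-open cube. -/
theorem tendsto_measureReal_box_sub {n : ℕ} {μs : ℕ → Measure (Cube n)} {μ : Measure (Cube n)}
    [∀ N, IsFiniteMeasure (μs N)] [IsFiniteMeasure μ] (hμ : WeakLim μs μ)
    (h0 : ∀ (i : Fin n) (r : ℝ), μ {x | (x i : ℝ) = r} = 0) {a b : ℕ → Cube n}
    {a' b' : Fin n → ℝ} (ha : Tendsto (fun N i => (a N i : ℝ)) atTop (𝓝 a'))
    (hb : Tendsto (fun N i => (b N i : ℝ)) atTop (𝓝 b')) :
    Tendsto (fun N => (μs N).real (Icc (a N) (b N)) - μ.real (Icc (a N) (b N))) atTop (𝓝 0) := by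
  have hae : ∀ᵐ x ∂μ, (∀ i, (x i : ℝ) ≠ a' i) ∧ ∀ i, (x i : ℝ) ≠ b' i := by
    refine Filter.Eventually.and (ae_all_iff.2 fun i => ?_) (ae_all_iff.2 fun i => ?_)
    · rw [ae_iff]; simpa using h0 i (a' i)
    · rw [ae_iff]; simpa using h0 i (b' i)
  have hC : ∀ N x, |(Icc (a N) (b N)).indicator (fun _ => (1 : ℝ)) x| ≤ 1 := fun N x => by
    by_cases hx : x ∈ Icc (a N) (b N) <;> simp [hx]
  have hm : ∀ N (ν : Measure (Cube n)),
      AEStronglyMeasurable ((Icc (a N) (b N)).indicator (fun _ => (1 : ℝ))) ν := fun N ν =>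
    (measurable_const.indicator measurableSet_Icc).aestronglyMeasurable
  have key : ∀ νs : ℕ → Measure (Cube n), (∀ N, IsFiniteMeasure (νs N)) → WeakLim νs μ →
      Tendsto (fun N => (νs N).real (Icc (a N) (b N))) atTop (𝓝 (∫ x,
        {y : Cube n | ∀ i, a' i ≤ y i ∧ (y i : ℝ) ≤ b' i}.indicator (fun _ => (1 : ℝ)) x ∂μ)) := by
    intro νs _ hν
    have := hν.tendsto_integral (fun N => hm N (νs N)) hC
      (hae.mono fun x hx => tendsto_indicator_box ha hb hx.1 hx.2)
    refine this.congr fun N => ?_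
    rw [integral_indicator measurableSet_Icc, setIntegral_const]
    simp
  simpa using (key μs inferInstance hμ).sub (key (fun _ => μ) (fun _ => inferInstance) (.const μ))

theorem bddAbove_extremeNorm {n : ℕ} (μ ν : Measure (Cube n)) [IsFiniteMeasure μ]
    [IsFiniteMeasure ν] : BddAbove {r : ℝ | ∃ a b : Cube n, (∀ i, a i < b i) ∧
    r = |μ.real (Set.Icc a b) - ν.real (Set.Icc a b)|} := by
  refine ⟨μ.real univ + ν.real univ, ?_⟩
  rintro r ⟨a, b, -, rfl⟩
  have h1 : μ.real (Icc a b) ≤ μ.real univ := measureReal_mono (subset_univ _)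
  have h2 : ν.real (Icc a b) ≤ ν.real univ := measureReal_mono (subset_univ _)
  have h3 : 0 ≤ μ.real (Icc a b) := measureReal_nonneg
  have h4 : 0 ≤ ν.real (Icc a b) := measureReal_nonneg
  rw [abs_le]
  constructor <;> linarith

theorem extremeNorm_nonneg {n : ℕ} (μ ν : Measure (Cube n)) : 0 ≤ extremeNorm μ ν :=
  Real.sSup_nonneg (by rintro r ⟨a, b, -, rfl⟩; exact abs_nonneg _)

theorem exists_box_extremeNorm_lt {n : ℕ} (μ ν : Measure (Cube n)) {ε : ℝ} (hε : 0 < ε) :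
    ∃ a b : Cube n, extremeNorm μ ν - ε < |μ.real (Set.Icc a b) - ν.real (Set.Icc a b)| := by
  have hne : {r : ℝ | ∃ a b : Cube n, (∀ i, a i < b i) ∧
      r = |μ.real (Set.Icc a b) - ν.real (Set.Icc a b)|}.Nonempty :=
    ⟨_, fun _ => uiZero, fun _ => ⟨1 / 2, by norm_num, by norm_num⟩, fun _ => by
      rw [← Subtype.coe_lt_coe]; norm_num [uiZero], rfl⟩
  obtain ⟨r, ⟨a, b, -, rfl⟩, hr⟩ := exists_lt_of_lt_csSup hne (sub_lt_self (extremeNorm μ ν) hε)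
  exact ⟨a, b, hr⟩

/-- Weak convergence to a measure that does not charge the hyperplanes parallel to the axes is
uniform over the boxes. -/
theorem WeakLim.tendsto_extremeNorm {n : ℕ} {μs : ℕ → Measure (Cube n)} {μ : Measure (Cube n)}
    [∀ N, IsFiniteMeasure (μs N)] [IsFiniteMeasure μ] (hμ : WeakLim μs μ)
    (h0 : ∀ (i : Fin n) (r : ℝ), μ {x | (x i : ℝ) = r} = 0) :
    Tendsto (fun N => extremeNorm (μs N) μ) atTop (𝓝 0) := by
  choose a b hab using fun N : ℕ =>
    exists_box_extremeNorm_lt (μs N) μ (ε := 1 / ((N : ℝ) + 1)) (by positivity)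
  have h1 : Tendsto (fun N => |(μs N).real (Icc (a N) (b N)) - μ.real (Icc (a N) (b N))|) atTop
      (𝓝 0) := by
    -- Along a further subsequence, the corners of the nearly extremal boxes converge in the compact
    -- cube `[0,1]^n`.
    refine tendsto_of_subseq_tendsto fun ns hns => ?_
    have hc : IsCompact (Icc (0 : Fin n → ℝ) 1) := isCompact_Icc
    have hmem : ∀ c : Cube n, (fun i => (c i : ℝ)) ∈ Icc (0 : Fin n → ℝ) 1 := fun c =>
      ⟨fun i => (c i).2.1, fun i => (c i).2.2.le⟩
    obtain ⟨a', -, φ, hφ, ha⟩ := hc.tendsto_subseq (fun k => hmem (a (ns k)))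
    obtain ⟨b', -, ψ, hψ, hb⟩ := hc.tendsto_subseq (fun k => hmem (b (ns (φ k))))
    refine ⟨fun k => φ (ψ k), ?_⟩
    have := tendsto_measureReal_box_sub
      (hμ.comp (hns.comp (hφ.tendsto_atTop.comp hψ.tendsto_atTop))) h0
      (a := fun k => a (ns (φ (ψ k)))) (b := fun k => b (ns (φ (ψ k))))
      (ha.comp hψ.tendsto_atTop) hb
    simpa using this.abs
  have h2 : Tendsto (fun N : ℕ => 1 / ((N : ℝ) + 1)) atTop (𝓝 0) :=
    tendsto_one_div_add_atTop_nhds_zero_nat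
  refine squeeze_zero (fun N => extremeNorm_nonneg _ _) (fun N => ?_) (by simpa only [add_zero] using h1.add h2)
  linarith [hab N]

/-! ### Lebesgue measure on the cube and empirical measures -/

theorem measurableEmbedding_coe_UI : MeasurableEmbedding (Subtype.val : UI → ℝ) :=
  MeasurableEmbedding.subtype_coe measurableSet_Ico

theorem lebUI_apply (s : Set UI) : lebUI s = volume ((↑) '' s : Set ℝ) :=
  measurableEmbedding_coe_UI.comap_apply _ _

theorem lebUI_Icc (s t : UI) : lebUI (Icc s t) = ENNReal.ofReal (t - s) := by
  have h : ((↑) '' (Icc s t) : Set ℝ) = Icc (s : ℝ) t := by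
    ext r
    constructor
    · rintro ⟨x, hx, rfl⟩
      exact hx
    · intro hr
      exact ⟨⟨r, s.2.1.trans hr.1, hr.2.trans_lt t.2.2⟩, hr, rfl⟩
  rw [lebUI_apply, h, Real.volume_Icc]

theorem lebUI_Iic (s : UI) : lebUI (Iic s) = ENNReal.ofReal s := by
  have h : Iic s = Icc uiZero s := by
    ext x
    exact ⟨fun hx => ⟨x.2.1, hx⟩, fun hx => hx.2⟩
  rw [h, lebUI_Icc]
  simp [uiZero]

instance : IsProbabilityMeasure lebUI := ⟨by
  rw [lebUI_apply, image_univ, Subtype.range_coe]; simp⟩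

instance : NullSingletonClass lebUI := ⟨fun x => by rw [lebUI_apply, image_singleton]; simp⟩

instance (n : ℕ) : IsProbabilityMeasure (lebCube n) := by unfold lebCube; infer_instance

theorem lebCube_hyperplane {n : ℕ} (i : Fin n) (r : ℝ) : lebCube n {x | (x i : ℝ) = r} = 0 := by
  have hs : {s : UI | (s : ℝ) = r}.Subsingleton := fun s hs t ht => Subtype.ext (hs.trans ht.symm)
  have h2 := (measurePreserving_eval (fun _ : Fin n => lebUI) i).measure_preimage
    hs.measurableSet.nullMeasurableSet
  exact h2.trans (hs.measure_zero _)

theorem empirical_univ {n N : ℕ} (hN : N ≠ 0) (x : Fin N → Cube n) : empirical x univ = 1 := by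
  simp only [empirical, Measure.smul_apply, Measure.coe_finsetSum, Finset.sum_apply, measure_univ,
    Finset.sum_const, Finset.card_univ, Fintype.card_fin, smul_eq_mul, nsmul_eq_mul, mul_one]
  exact ENNReal.inv_mul_cancel (by simpa using hN) (by simp)

instance {n N : ℕ} (x : Fin N → Cube n) : IsFiniteMeasure (empirical x) := by
  rcases eq_or_ne N 0 with rfl | hN
  · constructor; simp [empirical]
  · exact ⟨by rw [empirical_univ hN]; simp⟩

theorem aestronglyMeasurable_sum_dirac {X ι : Type*} [MeasurableSpace X]
    [MeasurableSingletonClass X] [Fintype ι] (x : ι → X) (f : X → ℝ) :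
    AEStronglyMeasurable f (∑ k, Measure.dirac (x k)) := by
  rw [← Measure.sum_fintype, aestronglyMeasurable_sum_measure_iff]
  exact fun _ => aestronglyMeasurable_dirac

theorem aestronglyMeasurable_empirical {n N : ℕ} (x : Fin N → Cube n) (f : Cube n → ℝ) :
    AEStronglyMeasurable f (empirical x) :=
  (aestronglyMeasurable_sum_dirac x f).smul_measure _

theorem integral_empirical {n N : ℕ} (x : Fin N → Cube n) (f : Cube n → ℝ) :
    ∫ y, f y ∂empirical x = (N : ℝ)⁻¹ * ∑ k, f (x k) := by
  rw [empirical, integral_smul_measure, integral_finsetSum_measure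
    (fun k _ => integrable_dirac (by simp))]
  simp [integral_dirac]

theorem Particles.integral_measure {d N : ℕ} (P : Particles d N) (f : Cube d → ℝ) :
    ∫ y, f y ∂P.measure = ∑ k, (P.W k : ℝ) * f (P.x k) := by
  rw [Particles.measure, integral_finsetSum_measure
    (fun k _ => (integrable_dirac (by simp)).smul_measure_nnreal)]
  simp [integral_smul_nnreal_measure, NNReal.smul_def]

theorem Particles.aestronglyMeasurable {d N : ℕ} (P : Particles d N) (f : Cube d → ℝ) :
    AEStronglyMeasurable f P.measure := by
  rw [Particles.measure, ← Measure.sum_fintype, aestronglyMeasurable_sum_measure_iff]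
  exact fun _ => aestronglyMeasurable_dirac.smul_measure _

instance {d N : ℕ} (P : Particles d N) : IsFiniteMeasure P.measure := by
  unfold Particles.measure; infer_instance

theorem le_extremeNorm {n : ℕ} (μ ν : Measure (Cube n)) [IsFiniteMeasure μ]
    [IsFiniteMeasure ν] {a b : Cube n} (hab : ∀ i, a i < b i) :
    |μ.real (Set.Icc a b) - ν.real (Set.Icc a b)| ≤ extremeNorm μ ν :=
  le_csSup (bddAbove_extremeNorm μ ν) ⟨a, b, hab, rfl⟩

theorem measureReal_lebCube_Icc_le {n : ℕ} (a b : Cube n) (i : Fin n) :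
    (lebCube n).real (Icc a b) ≤ (lebUI).real (Icc (a i) (b i)) := by
  have h := (measurePreserving_eval (fun _ : Fin n => lebUI) i).measureReal_preimage
    (measurableSet_Icc (a := a i) (b := b i)).nullMeasurableSet
  rw [← h]
  exact measureReal_mono fun x hx => ⟨hx.1 i, hx.2 i⟩

/-- A point strictly between `s` and `1`, at distance at most `δ` from `s`. -/
theorem exists_UI_gt (s : UI) {δ : ℝ} (hδ : 0 < δ) : ∃ t : UI, s < t ∧ (t : ℝ) ≤ s + δ := by
  obtain ⟨r, hr1, hr2⟩ := exists_between (lt_min (lt_add_of_pos_right (s : ℝ) hδ) s.2.2)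
  exact ⟨⟨r, s.2.1.trans hr1.le, hr2.trans_le (min_le_right _ _)⟩, hr1,
    hr2.le.trans (min_le_left _ _)⟩

/-- The extreme norm tests only boxes with all sides nondegenerate. A reversed side makes the box
empty; a flat box is Lebesgue-null and sits inside slightly larger admissible boxes of small volume.
-/
theorem tendsto_measureReal_box {n : ℕ} {μs : ℕ → Measure (Cube n)}
    [∀ N, IsFiniteMeasure (μs N)]
    (h : Tendsto (fun N => extremeNorm (μs N) (lebCube n)) atTop (𝓝 0)) (a b : Cube n) :
    Tendsto (fun N => (μs N).real (Icc a b)) atTop (𝓝 ((lebCube n).real (Icc a b))) := by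
  have key : ∀ a b : Cube n, (∀ i, a i < b i) →
      Tendsto (fun N => (μs N).real (Icc a b)) atTop (𝓝 ((lebCube n).real (Icc a b))) := by
    intro a b hab
    rw [tendsto_iff_dist_tendsto_zero]
    exact squeeze_zero (fun _ => dist_nonneg) (fun N => le_extremeNorm (μs N) _ hab) h
  by_cases hab : ∀ i, a i < b i
  · exact key a b hab
  push Not at hab
  obtain ⟨i, hi⟩ := hab
  rcases hi.lt_or_eq with hi | hi
  · have : Icc a b = ∅ := Icc_eq_empty fun hle => absurd (hle i) (not_le.2 hi)
    simp [this]
  by_cases hle : a ≤ b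
  swap
  · simp [Icc_eq_empty hle]
  have h0 : (lebCube n).real (Icc a b) = 0 := by
    refine le_antisymm ((measureReal_lebCube_Icc_le a b i).trans ?_) measureReal_nonneg
    simp [measureReal_def, hi]
  rw [h0, tendsto_order]
  refine ⟨fun c hc => Eventually.of_forall fun N => hc.trans_le measureReal_nonneg,
    fun c hc => ?_⟩
  choose b' hb1 hb2 using fun j => exists_UI_gt (b j) (half_pos hc)
  have h1 : (lebCube n).real (Icc a b') < c := by
    refine (measureReal_lebCube_Icc_le a b' i).trans_lt ?_
    rw [measureReal_def, lebUI_Icc, hi.symm]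
    have h2 : (b i : ℝ) < b' i := hb1 i
    rw [ENNReal.toReal_ofReal (by linarith)]
    linarith [hb2 i]
  filter_upwards [(key a b' fun j => (hle j).trans_lt (hb1 j)).eventually_lt_const h1] with N hN
  exact (measureReal_mono (Icc_subset_Icc_right fun j => (hb1 j).le)).trans_lt hN

theorem exists_box_subset {n : ℕ} {U : Set (Cube n)} (hU : IsOpen U) {x : Cube n} (hx : x ∈ U) :
    ∃ a b : Cube n, Icc a b ∈ 𝓝 x ∧ Icc a b ⊆ U := by
  obtain ⟨V, hV, hVU⟩ := isOpen_pi_iff'.1 hU x hx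
  choose a b _ hmem hsub using fun i =>
    exists_Icc_mem_subset_of_mem_nhds ((hV i).1.mem_nhds (hV i).2)
  refine ⟨a, b, ?_, ?_⟩
  · rw [← pi_univ_Icc]
    exact set_pi_mem_nhds finite_univ fun i _ => hmem i
  · rw [← pi_univ_Icc]
    exact (pi_mono fun i _ => hsub i).trans hVU

/-- Low-discrepancy point sets are asymptotically equidistributed. -/
theorem weakLim_of_discrepancy {n : ℕ} {u : (N : ℕ) → Fin N → Cube n}
    (h : Tendsto (fun N => discrepancy (u N)) atTop (𝓝 0)) :
    WeakLim (fun N => empirical (u N)) (lebCube n) := by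
  -- The shift avoids `N = 0`, where the empirical measure is zero.
  have hp : ∀ N, IsProbabilityMeasure (empirical (u (N + 1))) := fun N =>
    ⟨empirical_univ (Nat.succ_ne_zero N) _⟩
  let S : Set (Set (Cube n)) := {s | ∃ a b, s = Icc a b}
  have hS : IsPiSystem S := by
    rintro _ ⟨a, b, rfl⟩ _ ⟨a', b', rfl⟩ -
    exact ⟨_, _, Icc_inter_Icc⟩
  have key := hS.tendsto_probabilityMeasure_of_tendsto_of_mem (l := atTop)
    (μ := fun N : ℕ => (⟨empirical (u (N + 1)), hp N⟩ : ProbabilityMeasure (Cube n)))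
    (ν := ⟨lebCube n, inferInstance⟩) (by rintro _ ⟨a, b, rfl⟩; exact measurableSet_Icc)
    (fun U hU x hx => by
      obtain ⟨a, b, h1, h2⟩ := exists_box_subset hU hx
      exact ⟨_, ⟨a, b, rfl⟩, h1, h2⟩)
    (by
      rintro _ ⟨a, b, rfl⟩
      rw [← NNReal.tendsto_coe]
      exact (tendsto_add_atTop_iff_nat 1).2 (tendsto_measureReal_box h a b))
  intro f hf ⟨C, hC⟩
  have h1 := (ProbabilityMeasure.tendsto_iff_forall_integral_tendsto.1 key)
    (BoundedContinuousFunction.ofNormedAddCommGroup f hf C hC)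
  exact (tendsto_add_atTop_iff_nat 1).1 h1

/-! ### Quantile functions of atomless laws with full support -/

/-- A probability measure on `[0,1)` with a continuous and strictly increasing distribution
function. -/
structure IsRegularLaw (μ : Measure UI) : Prop where
  prob : IsProbabilityMeasure μ
  noAtoms : NullSingletonClass μ
  strictMono : StrictMono fun s => μ.real (Iic s)

theorem toUI_coe (s : UI) : toUI s = s := by
  unfold toUI
  rw [dif_pos s.2]

instance : PreconnectedSpace UI := Subtype.preconnectedSpace isPreconnected_Ico

namespace IsRegularLaw

variable {μ : Measure UI} (hμ : IsRegularLaw μ)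
include hμ

theorem continuous_cdf : Continuous fun s => μ.real (Iic s) := by
  have := hμ.prob
  have := hμ.noAtoms
  have h : ∀ s, μ.real (Iic s) = ∫ x, (Iic s).indicator (fun _ => (1 : ℝ)) x ∂μ := fun s => by
    rw [integral_indicator measurableSet_Iic]
    simp
  simp_rw [h]
  rw [continuous_iff_continuousAt]
  intro s
  refine continuousAt_of_dominated (bound := fun _ => 1) (Eventually.of_forall fun t =>
    (measurable_const.indicator measurableSet_Iic).aestronglyMeasurable)
    (Eventually.of_forall fun t => Eventually.of_forall fun x => ?_) (integrable_const _) ?_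
  · by_cases hx : x ∈ Iic t <;> simp [hx]
  · have hs : ∀ᵐ x ∂μ, x ≠ s := by simp [ae_iff]
    filter_upwards [hs] with x hx
    rcases lt_or_gt_of_ne hx with hx | hx
    · refine continuousAt_const.congr (f := fun _ => (1 : ℝ)) ?_
      filter_upwards [eventually_gt_nhds hx] with t ht
      rw [indicator_of_mem (show x ∈ Iic t from ht.le)]
    · refine continuousAt_const.congr (f := fun _ => (0 : ℝ)) ?_
      filter_upwards [eventually_lt_nhds hx] with t ht
      rw [indicator_of_notMem (show x ∉ Iic t from not_le.2 ht)]

/-- `[0,1)` has no largest element, so strict monotonicity leaves room below `1`. -/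
theorem cdf_lt_one (s : UI) : μ.real (Iic s) < 1 := by
  have := hμ.prob
  obtain ⟨t, ht, -⟩ := exists_UI_gt s one_pos
  exact (hμ.strictMono ht).trans_le measureReal_le_one

theorem exists_lt_cdf {u : ℝ} (hu : u < 1) : ∃ s, u < μ.real (Iic s) := by
  have := hμ.prob
  have : Nonempty UI := ⟨uiZero⟩
  have h := (ENNReal.tendsto_toReal (measure_ne_top μ univ)).comp (tendsto_measure_Iic_atTop μ)
  exact (h.eventually_const_lt (by simpa using hu)).exists

/-- The distribution function runs continuously from `0` at the origin (no atom there) to values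
above `u`, so it attains `u` at some `q`. By strict monotonicity the set in the definition of
`quantile` is `[q, 1)`. -/
theorem cdf_quantile (u : UI) : μ.real (Iic (quantile μ u)) = u := by
  have := hμ.prob
  have := hμ.noAtoms
  obtain ⟨s, hs⟩ := hμ.exists_lt_cdf u.2.2
  have h0 : μ.real (Iic uiZero) = 0 := by
    have : Iic uiZero = {uiZero} := by
      ext x
      exact ⟨fun hx => le_antisymm hx x.2.1, fun hx => le_of_eq hx⟩
    rw [this, measureReal_def, measure_singleton, ENNReal.toReal_zero]
  obtain ⟨q, hq⟩ := intermediate_value_univ uiZero s hμ.continuous_cdf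
    ⟨h0.trans_le u.2.1, hs.le⟩
  have hset : {r : ℝ | ∃ x : UI, (x : ℝ) = r ∧ (u : ℝ) ≤ μ.real (Set.Iic x)} =
      (↑) '' Ici q := by
    ext r
    constructor
    · rintro ⟨x, rfl, hx⟩
      refine ⟨x, hμ.strictMono.le_iff_le.1 ?_, rfl⟩
      simpa [hq] using hx
    · rintro ⟨x, hx, rfl⟩
      refine ⟨x, rfl, ?_⟩
      have := hμ.strictMono.monotone hx
      simpa [hq] using this
  have hleast : IsLeast ((↑) '' Ici q : Set ℝ) (q : ℝ) :=
    ⟨⟨q, le_refl q, rfl⟩, by rintro _ ⟨x, hx, rfl⟩; exact hx⟩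
  rw [quantile, hset, hleast.csInf_eq, toUI_coe]
  exact hq

theorem quantile_le_iff (u s : UI) : quantile μ u ≤ s ↔ (u : ℝ) ≤ μ.real (Iic s) := by
  rw [← hμ.strictMono.le_iff_le, hμ.cdf_quantile]

theorem lt_quantile_iff (u s : UI) : s < quantile μ u ↔ μ.real (Iic s) < u := by
  rw [← not_le, hμ.quantile_le_iff, not_le]

theorem quantile_lt_iff (u s : UI) : quantile μ u < s ↔ (u : ℝ) < μ.real (Iic s) := by
  rw [← hμ.strictMono.lt_iff_lt, hμ.cdf_quantile]

theorem measurable_quantile : Measurable (quantile μ) := by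
  refine measurable_of_Iic fun s => ?_
  have h : quantile μ ⁻¹' Iic s = {u : UI | (u : ℝ) ≤ μ.real (Iic s)} := by
    ext u
    exact hμ.quantile_le_iff u s
  rw [h]
  exact measurableSet_le measurable_subtype_coe measurable_const

theorem map_quantile : lebUI.map (quantile μ) = μ := by
  have := hμ.prob
  have : IsFiniteMeasure (lebUI.map (quantile μ)) := Measure.isFiniteMeasure_map _ _
  refine Measure.ext_of_Iic _ _ fun s => ?_
  rw [Measure.map_apply hμ.measurable_quantile measurableSet_Iic]
  have h : quantile μ ⁻¹' Iic s = Iic ⟨μ.real (Iic s), measureReal_nonneg, hμ.cdf_lt_one s⟩ := by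
    ext u
    exact hμ.quantile_le_iff u s
  rw [h, lebUI_Iic, ofReal_measureReal]

end IsRegularLaw

/-! ### Products and kernels -/

/-- Simulation of a kernel by independent noise `ν`: used for one coordinate of the Rosenblatt
recursion and for the whole mutation step. -/
theorem map_prod_eq_compProd {α β γ : Type*} [MeasurableSpace α] [MeasurableSpace β]
    [MeasurableSpace γ] {μ : Measure α} [SFinite μ] {ν : Measure β} [SFinite ν] {κ : Kernel α γ}
    [IsSFiniteKernel κ] {g : α × β → γ} (hg : Measurable g)
    (h : ∀ᵐ a ∂μ, ν.map (fun b => g (a, b)) = κ a) :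
    (μ.prod ν).map (fun p => (p.1, g p)) = μ ⊗ₘ κ := by
  ext s hs
  have hm : Measurable fun p : α × β => (p.1, g p) := measurable_fst.prodMk hg
  rw [Measure.map_apply hm hs, Measure.prod_apply (hm hs), Measure.compProd_apply hs]
  refine lintegral_congr_ae (h.mono fun a ha => ?_)
  have hga : Measurable fun b => g (a, b) := hg.comp measurable_prodMk_left
  simp only [← ha]
  rw [Measure.map_apply hga (measurable_prodMk_left hs)]
  rfl

/-! ### Inverse Rosenblatt transforms -/

theorem rosenblattInv_congr {d : ℕ} (κ : CondFamily d) {u v : Cube d} (i : Fin d)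
    (h : ∀ j ≤ i, u j = v j) : rosenblattInv κ u i = rosenblattInv κ v i := by
  induction i using WellFoundedLT.induction with
  | ind i ih =>
    rw [rosenblattInv, rosenblattInv, h i le_rfl]
    congr 2
    funext j
    exact ih j.1 j.2 fun k hk => h k (hk.trans j.2.le)

/-- Strong induction on the coordinate. In the order topology of `[0,1)` it suffices that `a <
quantile` and `quantile < b` are open conditions; they read `F(a) < u` and `u < F(b)`, with both
sides continuous in the parameters. -/
theorem continuous_rosenblattInv {d : ℕ} {κ : Cube d → CondFamily d}
    (hc : Continuous fun p : Cube d × Cube d => rosenblatt (κ p.1) p.2)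
    (hκ : ∀ x' i y, IsRegularLaw (κ x' i y)) :
    Continuous fun p : Cube d × Cube d => rosenblattInv (κ p.1) p.2 := by
  refine continuous_pi fun i => ?_
  induction i using WellFoundedLT.induction with
  | ind i ih =>
    -- The coordinates from `i` on are padded so that `hc`, which concerns full points, can be
    -- evaluated at the coordinates already treated.
    let E : Cube d × Cube d → Cube d := fun p j =>
      if j < i then rosenblattInv (κ p.1) p.2 j else uiZero
    have hE : Continuous E := by
      refine continuous_pi fun j => ?_
      by_cases hj : j < i
      · simpa only [E, if_pos hj] using ih j hj
      · simpa only [E, if_neg hj] using continuous_const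
    have hF : ∀ s : UI, Continuous fun p : Cube d × Cube d =>
        (κ p.1 i (fun j => rosenblattInv (κ p.1) p.2 j.1)).real (Iic s) := by
      intro s
      have h1 : Continuous fun p : Cube d × Cube d =>
          rosenblatt (κ p.1) (Function.update (E p) i s) i :=
        (continuous_apply i).comp (hc.comp (continuous_fst.prodMk (hE.update i continuous_const)))
      refine h1.congr fun p => ?_
      have h2 : initialCoords i (Function.update (E p) i s) =
          fun j => rosenblattInv (κ p.1) p.2 j.1 := by
        funext j
        have hj : j.1 ≠ i := j.2.ne
        simp only [initialCoords, Function.update_of_ne hj, E, if_pos j.2]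
      simp only [rosenblatt, h2, Function.update_self]
    have hu : Continuous fun p : Cube d × Cube d => ((p.2 i : UI) : ℝ) := by fun_prop
    rw [continuous_iff_continuousAt]
    intro p
    simp only [ContinuousAt]
    have hrec : ∀ p : Cube d × Cube d, rosenblattInv (κ p.1) p.2 i =
        quantile (κ p.1 i (fun j => rosenblattInv (κ p.1) p.2 j.1)) (p.2 i) := fun p => by
      rw [rosenblattInv]
    simp_rw [hrec]
    rw [tendsto_order]
    constructor
    · intro a ha
      rw [(hκ _ _ _).lt_quantile_iff] at ha
      filter_upwards [((hF a).tendsto p).eventually_lt (hu.tendsto p) ha] with q hq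
      exact ((hκ _ _ _).lt_quantile_iff _ _).2 hq
    · intro b hb
      rw [gt_iff_lt, (hκ _ _ _).quantile_lt_iff] at hb
      filter_upwards [(hu.tendsto p).eventually_lt ((hF b).tendsto p) hb] with q hq
      exact ((hκ _ _ _).quantile_lt_iff _ _).2 hq

theorem measurable_initialCoords {d : ℕ} (i : Fin d) : Measurable (initialCoords i) :=
  measurable_pi_lambda _ fun j => measurable_pi_apply j.1

/-- The inverse transform is triangular: its coordinates before `i` depend only on the `u j` with `j
< i`, which are independent of `u i` under Lebesgue measure. -/
theorem map_initialCoords_rosenblattInv_prod {d : ℕ} {κ : CondFamily d}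
    (hm : Measurable (rosenblattInv κ)) (i : Fin d) :
    (lebCube d).map (fun u => (initialCoords i (rosenblattInv κ u), u i)) =
      ((lebCube d).map (fun u => initialCoords i (rosenblattInv κ u))).prod lebUI := by
  have hind : iIndepFun (fun (j : Fin d) (u : Cube d) => u j) (lebCube d) :=
    iIndepFun_pi (X := fun _ s => s) fun _ => aemeasurable_id
  have h1 := hind.indepFun_finset (Finset.Iio i) {i} (by simp) fun j => measurable_pi_apply j
  let ext : (Finset.Iio i → UI) → Cube d := fun z j =>
    if hj : j ∈ Finset.Iio i then z ⟨j, hj⟩ else uiZero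
  have hext : Measurable ext := by
    refine measurable_pi_lambda _ fun j => ?_
    by_cases hj : j ∈ Finset.Iio i
    · simp only [ext, dif_pos hj]
      exact measurable_pi_apply _
    · simp only [ext, dif_neg hj]
      exact measurable_const
  have hψ : Measurable fun z : ({i} : Finset (Fin d)) → UI => z ⟨i, Finset.mem_singleton_self i⟩ :=
    measurable_pi_apply _
  have h2 := h1.comp (φ := fun z => initialCoords i (rosenblattInv κ (ext z)))
    ((measurable_initialCoords i).comp (hm.comp hext)) hψ
  have h3 : (fun z => initialCoords i (rosenblattInv κ (ext z))) ∘
      (fun (u : Cube d) (j : Finset.Iio i) => u j) =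
      fun u => initialCoords i (rosenblattInv κ u) := by
    funext u j
    refine rosenblattInv_congr κ j.1 fun k hk => ?_
    simp only [ext]
    rw [dif_pos (Finset.mem_Iio.2 (hk.trans_lt j.2))]
  rw [h3] at h2
  have h4 := h2.map_prod_eq_prod_map_map
    ((measurable_initialCoords i).comp hm).aemeasurable (measurable_pi_apply i).aemeasurable
  have h5 : (lebCube d).map (fun u => u i) = lebUI :=
    (measurePreserving_eval (fun _ : Fin d => lebUI) i).map_eq
  refine h4.trans ?_
  congr 1

/-- The law of the first `k` coordinates is identified by induction on `k`: the next coordinate is a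
conditional quantile of an independent uniform variable, so it has conditional law `κ i`. -/
theorem map_rosenblattInv {d : ℕ} {π : Measure (Cube d)} [IsProbabilityMeasure π]
    {κ : CondFamily d} (hπ : IsConditionalFamily π κ) (hκ : ∀ i y, IsRegularLaw (κ i y))
    (hm : Measurable (rosenblattInv κ)) : (lebCube d).map (rosenblattInv κ) = π := by
  -- Indexing by a natural number lets the induction reach `k = d`, the full point. For `k < d`, `R
  -- k` is definitionally `initialCoords ⟨k, _⟩`.
  let R : (k : ℕ) → Cube d → ({j : Fin d // j.val < k} → UI) := fun k x j => x j.1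
  have hR : ∀ k, Measurable (R k) := fun k =>
    measurable_pi_lambda _ fun j => measurable_pi_apply j.1
  have key : ∀ k ≤ d, (lebCube d).map (fun u => R k (rosenblattInv κ u)) = π.map (R k) := by
    intro k
    induction k with
    | zero =>
      intro _
      have : IsEmpty {j : Fin d // j.val < 0} := ⟨fun j => absurd j.2 (Nat.not_lt_zero _)⟩
      ext s hs
      rcases Set.eq_empty_or_nonempty s with rfl | hne
      · simp
      · have hX : Measurable fun u => R 0 (rosenblattInv κ u) := (hR 0).comp hm
        rw [hne.eq_univ, Measure.map_apply hX MeasurableSet.univ,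
          Measure.map_apply (hR 0) MeasurableSet.univ]
        simp
    | succ k ih =>
      intro hk
      let i : Fin d := ⟨k, hk⟩
      have hmk := (hπ i).1
      have hXi : Measurable fun u => initialCoords i (rosenblattInv κ u) :=
        (measurable_initialCoords i).comp hm
      have hXi' : Measurable fun u => (initialCoords i (rosenblattInv κ u), u i) :=
        hXi.prodMk (measurable_pi_apply i)
      have hXi2 : Measurable fun u => (initialCoords i (rosenblattInv κ u), rosenblattInv κ u i) :=
        hXi.prodMk ((measurable_pi_apply i).comp hm)
      have ihk : (lebCube d).map (fun u => initialCoords i (rosenblattInv κ u)) =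
        π.map (initialCoords i) := ih (Nat.le_of_succ_le hk)
      have hq : Measurable fun p : InitialCoords i × UI => quantile (κ i p.1) p.2 := by
        refine measurable_of_Iic fun s => ?_
        have h : (fun p : InitialCoords i × UI => quantile (κ i p.1) p.2) ⁻¹' Iic s =
            {p | (p.2 : ℝ) ≤ (κ i p.1).real (Iic s)} := by
          ext p
          exact (hκ i p.1).quantile_le_iff p.2 s
        rw [h]
        exact measurableSet_le (measurable_subtype_coe.comp measurable_snd)
          (((κ i).measurable_coe measurableSet_Iic).comp measurable_fst).ennreal_toReal
      have h1 : (lebCube d).map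
          (fun u => (initialCoords i (rosenblattInv κ u), rosenblattInv κ u i)) =
          π.map (fun x => (initialCoords i x, x i)) := by
        have hpm : IsProbabilityMeasure (π.map (initialCoords i)) :=
          Measure.isProbabilityMeasure_map (measurable_initialCoords i).aemeasurable
        rw [(hπ i).2, ← map_prod_eq_compProd (ν := lebUI) hq
          (ae_of_all _ fun y => (hκ i y).map_quantile), ← ihk,
          ← map_initialCoords_rosenblattInv_prod hm i, Measure.map_map (measurable_fst.prodMk hq) hXi']
        congr 1
        funext u
        simp only [Function.comp]
        rw [rosenblattInv]
        rfl
      let g : InitialCoords i × UI → ({j : Fin d // j.val < k + 1} → UI) := fun p j =>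
        if hj : j.1 < i then p.1 ⟨j.1, hj⟩ else p.2
      have hg : Measurable g := by
        refine measurable_pi_lambda _ fun j => ?_
        by_cases hj : j.1 < i
        · simp only [g, dif_pos hj]
          exact (measurable_pi_apply _).comp measurable_fst
        · simp only [g, dif_neg hj]
          exact measurable_snd
      have hgR : ∀ x : Cube d, g (initialCoords i x, x i) = R (k + 1) x := by
        intro x
        funext j
        by_cases hj : j.1 < i
        · simp only [g, dif_pos hj, initialCoords, R]
        · have : j.1 = i := le_antisymm (Nat.lt_succ_iff.1 j.2) (not_lt.1 hj)
          simp only [g, dif_neg hj, R, this]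
      have h2 := congrArg (Measure.map g) h1
      rw [Measure.map_map hg hXi2, Measure.map_map hg
        ((measurable_initialCoords i).prodMk (measurable_pi_apply i))] at h2
      simpa only [Function.comp_def, hgR] using h2
  have h := congrArg (Measure.map fun (z : {j : Fin d // j.val < d} → UI) (j : Fin d) =>
    z ⟨j, j.2⟩) (key d le_rfl)
  have hz : Measurable fun (z : {j : Fin d // j.val < d} → UI) (j : Fin d) => z ⟨j, j.2⟩ :=
    measurable_pi_lambda _ fun j => measurable_pi_apply _
  have hX : Measurable fun u => R d (rosenblattInv κ u) := (hR d).comp hm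
  rw [Measure.map_map hz hX, Measure.map_map hz (hR d)] at h
  exact h.trans Measure.map_id

/-! ### Hilbert curves and their pseudo-inverses -/

/-- The interior of a dyadic cube, as a subset of `[0,1)^d`. -/
def openCell {d : ℕ} (m : ℕ) (c : Fin d → Fin (2 ^ m)) : Set (Cube d) :=
  {x | ∀ i, (c i : ℝ) / 2 ^ m < x i ∧ (x i : ℝ) < ((c i : ℝ) + 1) / 2 ^ m}

theorem isOpen_openCell {d : ℕ} (m : ℕ) (c : Fin d → Fin (2 ^ m)) : IsOpen (openCell m c) := by
  have h : openCell m c = ⋂ i, {x : Cube d | (c i : ℝ) / 2 ^ m < x i} ∩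
      {x : Cube d | (x i : ℝ) < ((c i : ℝ) + 1) / 2 ^ m} := by
    ext x
    simp [openCell]
  rw [h]
  exact isOpen_iInter_of_finite fun i =>
    (isOpen_lt continuous_const (by fun_prop)).inter (isOpen_lt (by fun_prop) continuous_const)

theorem exists_mem_hilbertInterval (d m : ℕ) (s : UI) :
    ∃ k, inclUI s ∈ hilbertInterval d m k := by
  have hpos : (0 : ℝ) < 2 ^ (m * d) := by positivity
  have h0 : 0 ≤ (s : ℝ) * 2 ^ (m * d) := mul_nonneg s.2.1 hpos.le
  have hlt : ⌊(s : ℝ) * 2 ^ (m * d)⌋₊ < 2 ^ (m * d) := by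
    rw [Nat.floor_lt h0]
    push_cast
    exact mul_lt_of_lt_one_left hpos s.2.2
  refine ⟨⟨_, hlt⟩, ?_, ?_⟩
  · exact (div_le_iff₀ hpos).2 (Nat.floor_le h0)
  · exact (le_div_iff₀ hpos).2 (Nat.lt_floor_add_one _).le

theorem exists_mem_openCell {d m : ℕ} {x : Cube d} (hx : ∀ i (c : ℕ), (x i : ℝ) ≠ c / 2 ^ m) :
    ∃ c : Fin d → Fin (2 ^ m), x ∈ openCell m c := by
  have hpos : (0 : ℝ) < 2 ^ m := by positivity
  have h0 : ∀ i, 0 ≤ (x i : ℝ) * 2 ^ m := fun i => mul_nonneg (x i).2.1 hpos.le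
  have hlt : ∀ i, ⌊(x i : ℝ) * 2 ^ m⌋₊ < 2 ^ m := fun i => by
    rw [Nat.floor_lt (h0 i)]
    push_cast
    exact mul_lt_of_lt_one_left hpos (x i).2.2
  refine ⟨fun i => ⟨_, hlt i⟩, fun i => ⟨lt_of_le_of_ne ?_ (hx i _).symm, ?_⟩⟩
  · exact (div_le_iff₀ hpos).2 (Nat.floor_le (h0 i))
  · exact (lt_div_iff₀ hpos).2 (Nat.lt_floor_add_one _)

theorem toCube_inclCube {d : ℕ} (x : Cube d) : toCube (inclCube x) = x :=
  funext fun i => toUI_coe (x i)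

section Hilbert

variable {d : ℕ} {H : C(unitInterval, Fin d → unitInterval)} {h : Cube d → UI}

theorem IsHilbertPseudoInverse.toCube_apply (hh : IsHilbertPseudoInverse H h) (x : Cube d) :
    toCube (H (inclUI (h x))) = x := by
  rw [hh.right_inv, toCube_inclCube]

theorem IsHilbertPseudoInverse.injective (hh : IsHilbertPseudoInverse H h) :
    Function.Injective h := fun x y hxy => by
  rw [← hh.toCube_apply x, hxy, hh.toCube_apply]

/-- A pseudo-inverse maps the interior of a dyadic cube to the corresponding interval. -/
theorem IsHilbertPseudoInverse.mem_hilbertInterval (hh : IsHilbertPseudoInverse H h) {m : ℕ}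
    {S : Fin (2 ^ (m * d)) → (Fin d → Fin (2 ^ m))} (hS : Function.Injective S)
    (hHS : ∀ k, H '' hilbertInterval d m k = dyadicCube m (S k)) {k : Fin (2 ^ (m * d))}
    {x : Cube d} (hx : x ∈ openCell m (S k)) : inclUI (h x) ∈ hilbertInterval d m k := by
  obtain ⟨l, hl⟩ := exists_mem_hilbertInterval d m (h x)
  have h1 : inclCube x ∈ dyadicCube m (S l) := by
    rw [← hHS, ← hh.right_inv x]
    exact mem_image_of_mem _ hl
  have hpos : (0 : ℝ) < 2 ^ m := by positivity
  -- `x` is interior to one cell and belongs to the other closed cell of the same level, so the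
  -- integer corners differ by less than one in each coordinate.
  have h2 : S l = S k := by
    funext i
    obtain ⟨ha, hb⟩ := h1 i
    obtain ⟨ha', hb'⟩ := hx i
    have hab : ((S l i : ℕ) : ℝ) < (S k i : ℕ) + 1 :=
      (div_lt_div_iff_of_pos_right hpos).1 (lt_of_le_of_lt ha hb')
    have hba : ((S k i : ℕ) : ℝ) < (S l i : ℕ) + 1 :=
      (div_lt_div_iff_of_pos_right hpos).1 (lt_of_lt_of_le ha' hb)
    norm_cast at hab hba
    exact Fin.ext (by omega)
  rwa [← hS h2]

/-- A point without dyadic coordinates is interior to a cell at every level, and `h` maps that open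
cell into one interval of length `2^{-md}`, which tends to zero since `d ≥ 1`. -/
theorem IsHilbertCurve.continuousAt_pseudoInverse (hd : 1 ≤ d) (hH : IsHilbertCurve H)
    (hh : IsHilbertPseudoInverse H h) {x : Cube d}
    (hx : ∀ (m : ℕ) i (c : ℕ), (x i : ℝ) ≠ c / 2 ^ m) : ContinuousAt h x := by
  rw [Metric.continuousAt_iff']
  intro ε hε
  obtain ⟨m, hm⟩ := exists_pow_lt_of_lt_one hε (by norm_num : (1 / 2 : ℝ) < 1)
  obtain ⟨S, hS, hHS, -⟩ := hH.cells m
  obtain ⟨c, hc⟩ := exists_mem_openCell (hx m)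
  obtain ⟨k, rfl⟩ := hS.2 c
  filter_upwards [(isOpen_openCell m (S k)).mem_nhds hc] with y hy
  obtain ⟨h1, h2⟩ := hh.mem_hilbertInterval hS.1 hHS hy
  obtain ⟨h3, h4⟩ := hh.mem_hilbertInterval hS.1 hHS hc
  simp only [inclUI] at h1 h2 h3 h4
  have hle : (1 : ℝ) / 2 ^ (m * d) ≤ (1 / 2) ^ m := by
    rw [one_div_pow]
    exact one_div_le_one_div_of_le (by positivity)
      (pow_le_pow_right₀ one_le_two (Nat.le_mul_of_pos_right m hd))
  rw [add_div] at h2 h4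
  rw [Subtype.dist_eq, Real.dist_eq, abs_lt]
  constructor <;> linarith

theorem ae_ne_dyadic {Q : Measure (Cube d)} (hQ : ∀ (i : Fin d) (r : ℝ), Q {x | (x i : ℝ) = r} = 0) :
    ∀ᵐ x ∂Q, ∀ (m : ℕ) (i : Fin d) (c : ℕ), (x i : ℝ) ≠ c / 2 ^ m := by
  refine ae_all_iff.2 fun m => ae_all_iff.2 fun i => ae_all_iff.2 fun c => ?_
  rw [ae_iff]
  simpa using hQ i _

theorem withDensity_pos {p : Cube d → ℝ≥0} (hp : Measurable p) (hpos : ∀ x, 0 < p x)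
    {s : Set (Cube d)} (hs : MeasurableSet s) (h0 : lebCube d s ≠ 0) :
    (lebCube d).withDensity (fun x => (p x : ℝ≥0∞)) s ≠ 0 := by
  rw [withDensity_apply _ hs]
  intro h1
  rw [lintegral_eq_zero_iff hp.coe_nnreal_ennreal] at h1
  have h2 : ∀ᵐ x ∂(lebCube d).restrict s, False := by
    filter_upwards [h1] with x hx
    exact absurd hx (by simpa using (hpos x).ne')
  rw [eventually_false_iff_eq_bot, ae_eq_bot, Measure.restrict_eq_zero] at h2
  exact h0 h2

theorem lebCube_openCell_ne_zero (m : ℕ) (c : Fin d → Fin (2 ^ m)) :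
    lebCube d (openCell m c) ≠ 0 := by
  have hpos : (0 : ℝ) < 2 ^ m := by positivity
  have hc : ∀ i, ((c i : ℕ) : ℝ) + 1 ≤ 2 ^ m := fun i => by exact_mod_cast (c i).2
  have hmem : ∀ r : ℝ, 0 < r → r < 1 → ∀ i, ((c i : ℝ) + r) / 2 ^ m ∈ Ico (0 : ℝ) 1 :=
    fun r h0 h1 i => ⟨by positivity, by rw [div_lt_one hpos]; linarith [hc i]⟩
  let a : Cube d := fun i => ⟨_, hmem (1 / 3) (by norm_num) (by norm_num) i⟩
  let b : Cube d := fun i => ⟨_, hmem (2 / 3) (by norm_num) (by norm_num) i⟩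
  have hsub : Icc a b ⊆ openCell m c := by
    intro x hx i
    have h1 : ((c i : ℝ) + 1 / 3) / 2 ^ m ≤ x i := hx.1 i
    have h2 : (x i : ℝ) ≤ ((c i : ℝ) + 2 / 3) / 2 ^ m := hx.2 i
    refine ⟨lt_of_lt_of_le ?_ h1, lt_of_le_of_lt h2 ?_⟩
    · exact div_lt_div_of_pos_right (by linarith) hpos
    · exact div_lt_div_of_pos_right (by linarith) hpos
  refine fun h0 => absurd (measure_mono_null hsub h0) ?_
  rw [← pi_univ_Icc, lebCube, Measure.pi_pi]
  refine Finset.prod_ne_zero_iff.2 fun i _ => ?_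
  rw [lebUI_Icc]
  simp only [ne_eq, ENNReal.ofReal_eq_zero, not_le, sub_pos, a, b]
  exact div_lt_div_of_pos_right (by linarith) hpos

/-- The image on the Hilbert curve of a law with a positive density is regular. -/
theorem IsHilbertCurve.isRegularLaw_map (hd : 1 ≤ d) (hH : IsHilbertCurve H)
    (hh : IsHilbertPseudoInverse H h) {Q : Measure (Cube d)} [IsProbabilityMeasure Q]
    {p : Cube d → ℝ≥0} (hp : Measurable p) (hpos : ∀ x, 0 < p x)
    (hQ : Q = (lebCube d).withDensity (fun x => (p x : ℝ≥0∞))) : IsRegularLaw (Q.map h) := by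
  have hprob : IsProbabilityMeasure (Q.map h) :=
    Measure.isProbabilityMeasure_map hh.measurable.aemeasurable
  refine ⟨hprob, ⟨fun s => ?_⟩, fun a b hab => ?_⟩
  · rw [Measure.map_apply hh.measurable (measurableSet_singleton s)]
    -- No atoms: a fibre of `h` has at most one point, and a point lies in a Lebesgue-null
    -- hyperplane.
    have hss : (h ⁻¹' {s}).Subsingleton := fun x hx y hy => hh.injective (hx.trans hy.symm)
    rcases hss.eq_empty_or_singleton with h0 | ⟨x, hx⟩
    · rw [h0, measure_empty]
    · rw [hx, hQ]
      refine withDensity_absolutelyContinuous _ _ (measure_mono_null ?_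
        (lebCube_hyperplane ⟨0, hd⟩ (x ⟨0, hd⟩ : ℝ)))
      rintro y rfl
      rfl
  · have hab' : (0 : ℝ) < (b : ℝ) - a := sub_pos.2 hab
    -- At this level the interval containing the midpoint of `a` and `b` lies inside `(a, b)`. The
    -- corresponding open cell, of positive mass, is sent there by `h`.
    obtain ⟨m, hm⟩ := exists_pow_lt_of_lt_one (half_pos hab') (by norm_num : (1 / 2 : ℝ) < 1)
    obtain ⟨S, hS, hHS, -⟩ := hH.cells m
    have hle : (1 : ℝ) / 2 ^ (m * d) ≤ (1 / 2) ^ m := by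
      rw [one_div_pow]
      exact one_div_le_one_div_of_le (by positivity)
        (pow_le_pow_right₀ one_le_two (Nat.le_mul_of_pos_right m hd))
    obtain ⟨c, hc1⟩ : ∃ c : UI, (c : ℝ) = (a + b) / 2 :=
      ⟨⟨(a + b) / 2, by linarith [a.2.1, b.2.1], by linarith [a.2.2, b.2.2]⟩, rfl⟩
    obtain ⟨k, hk1, hk2⟩ := exists_mem_hilbertInterval d m c
    simp only [inclUI, hc1] at hk1 hk2
    rw [add_div ((k : ℕ) : ℝ)] at hk2
    have hsub : openCell m (S k) ⊆ h ⁻¹' Ioc a b := by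
      intro x hx
      obtain ⟨h1, h2⟩ := hh.mem_hilbertInterval hS.1 hHS hx
      simp only [inclUI] at h1 h2
      rw [add_div] at h2
      constructor
      · rw [← Subtype.coe_lt_coe]
        linarith
      · rw [← Subtype.coe_le_coe]
        linarith
    have hne : Q.map h (Ioc a b) ≠ 0 := by
      rw [Measure.map_apply hh.measurable measurableSet_Ioc]
      refine fun h0 => absurd (measure_mono_null hsub h0) ?_
      rw [hQ]
      exact withDensity_pos hp hpos (isOpen_openCell m _).measurableSet
        (lebCube_openCell_ne_zero m _)
    have hun : Iic b = Iic a ∪ Ioc a b := (Iic_union_Ioc_eq_Iic hab.le).symm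
    show (Q.map h).real (Iic a) < (Q.map h).real (Iic b)
    rw [hun, measureReal_union (Iic_disjoint_Ioc le_rfl) measurableSet_Ioc]
    exact lt_add_of_pos_right _ (measureReal_nonneg.lt_of_ne'
      (by rwa [Ne, measureReal_eq_zero_iff]))

/-- `toCube` replaces a coordinate equal to `1` by the default `0`, so continuity is claimed only
where no coordinate of `H` reaches `1`. -/
theorem continuousAt_toCube_hilbert {s : UI} (hs : ∀ i, ((H (inclUI s) i : unitInterval) : ℝ) < 1) :
    ContinuousAt (fun s : UI => toCube (H (inclUI s))) s := by
  have hincl : Continuous inclUI := Continuous.subtype_mk continuous_subtype_val _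
  refine continuousAt_pi.2 fun i => ?_
  have hc : Continuous (fun s : UI => ((H (inclUI s) i : unitInterval) : ℝ)) :=
    continuous_subtype_val.comp ((continuous_apply i).comp (H.continuous.comp hincl))
  rw [IsInducing.subtypeVal.continuousAt_iff]
  refine hc.continuousAt.congr ?_
  filter_upwards [hc.continuousAt.eventually_lt_const (hs i)] with t ht
  have hmem : ((H (inclUI t) i : unitInterval) : ℝ) ∈ Ico (0 : ℝ) 1 := ⟨(H (inclUI t) i).2.1, ht⟩
  simp only [Function.comp, toCube, toUI, dif_pos hmem]

theorem IsHilbertPseudoInverse.ae_lt_one (hh : IsHilbertPseudoInverse H h) (Q : Measure (Cube d)) :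
    ∀ᵐ s ∂Q.map h, ∀ i, ((H (inclUI s) i : unitInterval) : ℝ) < 1 := by
  have hincl : Continuous inclUI := Continuous.subtype_mk continuous_subtype_val _
  have hms : MeasurableSet {s : UI | ∀ i, ((H (inclUI s) i : unitInterval) : ℝ) < 1} := by
    refine MeasurableSet.congr (s := ⋂ i, {s : UI | ((H (inclUI s) i : unitInterval) : ℝ) < 1})
      (MeasurableSet.iInter fun i => ?_) (by ext s; simp)
    have hc : Continuous (fun s : UI => ((H (inclUI s) i : unitInterval) : ℝ)) :=
      continuous_subtype_val.comp ((continuous_apply i).comp (H.continuous.comp hincl))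
    exact measurableSet_lt hc.measurable measurable_const
  rw [ae_map_iff hh.measurable.aemeasurable hms]
  refine ae_of_all _ fun x i => ?_
  rw [hh.right_inv]
  exact (x i).2.2

end Hilbert

/-! ### Resampling -/

namespace Particles

variable {d N : ℕ}

/-- The resampled point as a function of the uniform variable. -/
noncomputable def resampleAt (h : Cube d → UI) (P : Particles d N) (w : UI) : Cube d :=
  if hs : (Finset.univ.filter (fun k => (w : ℝ) ≤ P.sortedCDF h k)).Nonempty then
    P.x (P.hilbertSort h ((Finset.univ.filter (fun k => (w : ℝ) ≤ P.sortedCDF h k)).min' hs))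
  else fun _ => uiZero

/-- With normalised weights the last cumulative weight is `1 > w`, so the minimum exists and the
default values in `resample` and `resampleAt` play no role. -/
theorem exists_resampleAt_eq (h : Cube d → UI) {P : Particles d N} (hW : ∑ k, P.W k = 1) (w : UI) :
    ∃ k, P.resampleAt h w = P.x (P.hilbertSort h k) ∧ (w : ℝ) ≤ P.sortedCDF h k ∧
      (∀ j < k, (P.sortedCDF h j : ℝ) < w) ∧
      ∀ (u : Fin N → UI) n, u n = w → P.resample h u n = P.x (P.hilbertSort h k) := by
  have hN : N ≠ 0 := by
    rintro rfl
    simp at hW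
  obtain ⟨N, rfl⟩ := Nat.exists_eq_succ_of_ne_zero hN
  obtain ⟨A, hA⟩ : ∃ A, A = Finset.univ.filter (fun k => (w : ℝ) ≤ P.sortedCDF h k) := ⟨_, rfl⟩
  have hmem : ∀ j, j ∈ A ↔ (w : ℝ) ≤ P.sortedCDF h j := fun j => by simp [hA]
  have hs : A.Nonempty := by
    refine ⟨Fin.last N, (hmem _).2 ?_⟩
    have h1 : P.sortedCDF h (Fin.last N) = 1 := by
      rw [← hW, sortedCDF, ← Equiv.sum_comp (P.hilbertSort h)]
      congr 1
      ext i
      simp [Fin.le_last]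
    rw [h1]
    exact w.2.2.le
  refine ⟨A.min' hs, ?_, (hmem _).1 (A.min'_mem hs), fun j hj => ?_, ?_⟩
  · subst hA
    rw [resampleAt, dif_pos hs]
  · by_contra hle
    exact absurd hj (not_lt.2 (A.min'_le j ((hmem j).2 (not_lt.1 hle))))
  · rintro u n rfl
    rw [resample, ← hA, ← Finset.coe_min' hs, WithTop.untopD_coe]

theorem resample_eq_resampleAt (h : Cube d → UI) {P : Particles d N} (hW : ∑ k, P.W k = 1)
    (u : Fin N → UI) (n : Fin N) : P.resample h u n = P.resampleAt h (u n) := by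
  obtain ⟨k, hk, -, -, hu⟩ := P.exists_resampleAt_eq h hW (u n)
  rw [hk, hu u n rfl]

theorem measureReal_preimage_Iic {h : Cube d → UI} (hh : Measurable h) (P : Particles d N)
    (s : UI) : P.measure.real (h ⁻¹' Iic s) =
      ∑ i with h (P.x (P.hilbertSort h i)) ≤ s, (P.W (P.hilbertSort h i) : ℝ) := by
  have h1 := P.integral_measure ((h ⁻¹' Iic s).indicator fun _ => (1 : ℝ))
  rw [integral_indicator (hh measurableSet_Iic), setIntegral_const, smul_eq_mul, mul_one,
    ← Equiv.sum_comp (P.hilbertSort h)] at h1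
  rw [h1, Finset.sum_filter]
  refine Finset.sum_congr rfl fun i _ => ?_
  by_cases hi : h (P.x (P.hilbertSort h i)) ≤ s
  · rw [if_pos hi, indicator_of_mem (show _ ∈ h ⁻¹' Iic s from hi), mul_one]
  · rw [if_neg hi, indicator_of_notMem (show _ ∉ h ⁻¹' Iic s from hi), mul_zero]

variable {h : Cube d → UI} {P : Particles d N}

theorem monotone_hilbertSort (h : Cube d → UI) (P : Particles d N) :
    Monotone fun i => h (P.x (P.hilbertSort h i)) :=
  Tuple.monotone_sort fun n => h (P.x n)

/-- By the sort, all particles up to the selected index have Hilbert index at most `s`, and their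
weights already add up to at least `w`. -/
theorem le_measureReal_of_resampleAt_le (hh : Measurable h) (hW : ∑ k, P.W k = 1) {w s : UI}
    (hs : h (P.resampleAt h w) ≤ s) : (w : ℝ) ≤ P.measure.real (h ⁻¹' Iic s) := by
  obtain ⟨k, hk, hw, -, -⟩ := P.exists_resampleAt_eq h hW w
  rw [measureReal_preimage_Iic hh]
  refine hw.trans ?_
  rw [sortedCDF, NNReal.coe_sum]
  refine Finset.sum_le_sum_of_subset_of_nonneg (fun i hi => ?_) fun _ _ _ => NNReal.coe_nonneg _
  refine Finset.mem_filter.2 ⟨Finset.mem_univ _, ?_⟩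
  rw [hk] at hs
  exact (P.monotone_hilbertSort h (Finset.mem_Iic.1 hi)).trans hs

/-- Particles with Hilbert index at most `s` come strictly before the selected index, where the
cumulative weight is still below `w`. If the first index is selected, that sum is empty, whence the
assumption `0 < w`. -/
theorem measureReal_lt_of_lt_resampleAt (hh : Measurable h) (hW : ∑ k, P.W k = 1) {w s : UI}
    (hw0 : (0 : ℝ) < w) (hs : s < h (P.resampleAt h w)) :
    P.measure.real (h ⁻¹' Iic s) < w := by
  obtain ⟨k, hk, -, hlt, -⟩ := P.exists_resampleAt_eq h hW w
  rw [hk] at hs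
  rw [measureReal_preimage_Iic hh]
  have hsub : (Finset.univ.filter fun i => h (P.x (P.hilbertSort h i)) ≤ s) ⊆ Finset.Iio k := by
    intro i hi
    rw [Finset.mem_Iio]
    by_contra hki
    have := P.monotone_hilbertSort h (not_lt.1 hki)
    exact absurd (hs.trans_le this) (not_lt.2 (Finset.mem_filter.1 hi).2)
  refine (Finset.sum_le_sum_of_subset_of_nonneg hsub fun _ _ _ => NNReal.coe_nonneg _).trans_lt ?_
  rcases Nat.eq_zero_or_pos k.val with hk0 | hk0
  · have : Finset.Iio k = ∅ := by
      ext i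
      simp only [Finset.mem_Iio, Fin.lt_def, hk0]
      simp
    rwa [this, Finset.sum_empty]
  · have hk1 : k.val - 1 < N := by omega
    have : Finset.Iio k = Finset.Iic ⟨k.val - 1, hk1⟩ := by
      ext i
      simp only [Finset.mem_Iio, Finset.mem_Iic, Fin.lt_def, Fin.le_def]
      omega
    rw [this]
    have := hlt ⟨k.val - 1, hk1⟩ (by rw [Fin.lt_def]; simp only; omega)
    rwa [sortedCDF, NNReal.coe_sum] at this

end Particles

section

variable {d : ℕ} {h : Cube d → UI} {P : (N : ℕ) → Particles d N} {Q : Measure (Cube d)}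
  [IsProbabilityMeasure Q]

/-- The indicator of `h ⁻¹' Iic s` is continuous at any continuity point `x` of `h` with `h x ≠ s`,
hence `Q`-almost everywhere. -/
theorem tendsto_measureReal_preimage_Iic (hP : WeakLim (fun N => (P N).measure) Q)
    (hh : Measurable h) (hc : ∀ᵐ x ∂Q, ContinuousAt h x) (h0 : ∀ s, Q (h ⁻¹' {s}) = 0) (s : UI) :
    Tendsto (fun N => (P N).measure.real (h ⁻¹' Iic s)) atTop (𝓝 (Q.real (h ⁻¹' Iic s))) := by
  have hms : MeasurableSet (h ⁻¹' Iic s) := hh measurableSet_Iic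
  have hne : ∀ᵐ x ∂Q, h x ≠ s := by
    simp only [ae_iff, not_not]
    exact h0 s
  have key := hP.tendsto_integral (f := fun _ => (h ⁻¹' Iic s).indicator fun _ => (1 : ℝ))
    (g := (h ⁻¹' Iic s).indicator fun _ => (1 : ℝ)) (C := 1)
    (fun N => (measurable_const.indicator hms).aestronglyMeasurable)
    (fun N x => by by_cases hx : x ∈ h ⁻¹' Iic s <;> simp [hx]) ?_
  · simpa [integral_indicator hms] using key
  · filter_upwards [hc, hne] with x hx hxs
    refine Tendsto.comp (g := (h ⁻¹' Iic s).indicator fun _ => (1 : ℝ)) ?_ tendsto_snd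
    rcases lt_or_gt_of_ne hxs with hlt | hlt
    · rw [indicator_of_mem (show x ∈ h ⁻¹' Iic s from hlt.le)]
      refine tendsto_const_nhds.congr' ?_
      filter_upwards [hx.eventually_lt_const hlt] with y hy
      rw [indicator_of_mem (show y ∈ h ⁻¹' Iic s from hy.le)]
    · rw [indicator_of_notMem (show x ∉ h ⁻¹' Iic s from not_le.2 hlt)]
      refine tendsto_const_nhds.congr' ?_
      filter_upwards [hx.eventually_const_lt hlt] with y hy
      rw [indicator_of_notMem (show y ∉ h ⁻¹' Iic s from not_le.2 hy)]

/-- The resampling map converges continuously to the quantile function of the limit. -/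
theorem tendsto_resampleAt (hP : WeakLim (fun N => (P N).measure) Q) (hh : Measurable h)
    (hc : ∀ᵐ x ∂Q, ContinuousAt h x) (hreg : IsRegularLaw (Q.map h))
    (hW : ∀ᶠ N in atTop, ∑ k, (P N).W k = 1) {w : UI} (hw : (0 : ℝ) < w) :
    Tendsto (fun p : ℕ × UI => h ((P p.1).resampleAt h p.2)) (atTop ×ˢ 𝓝 w)
      (𝓝 (quantile (Q.map h) w)) := by
  have hcdf : ∀ s, Tendsto (fun p : ℕ × UI => (P p.1).measure.real (h ⁻¹' Iic s)) (atTop ×ˢ 𝓝 w)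
      (𝓝 ((Q.map h).real (Iic s))) := fun s => by
    rw [map_measureReal_apply hh measurableSet_Iic]
    refine (tendsto_measureReal_preimage_Iic hP hh hc (fun t => ?_) s).comp tendsto_fst
    rw [← Measure.map_apply hh (measurableSet_singleton t)]
    exact hreg.noAtoms.measure_singleton t
  have hw' : Tendsto (fun p : ℕ × UI => (p.2 : ℝ)) (atTop ×ˢ 𝓝 w) (𝓝 w) :=
    (continuous_subtype_val.tendsto w).comp tendsto_snd
  have hWe : ∀ᶠ p : ℕ × UI in atTop ×ˢ 𝓝 w, ∑ k, (P p.1).W k = 1 := tendsto_fst.eventually hW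
  rw [tendsto_order]
  constructor
  · intro a ha
    rw [hreg.lt_quantile_iff] at ha
    filter_upwards [(hcdf a).eventually_lt hw' ha, hWe] with p hp hWp
    exact not_le.1 fun hle => absurd (Particles.le_measureReal_of_resampleAt_le hh hWp hle)
      (not_le.2 hp)
  · intro b hb
    have : DenselyOrdered UI := inferInstance
    -- The comparison with the distribution function yields only a weak upper bound, so it is made
    -- at some `c < b`.
    obtain ⟨c, hc1, hcb⟩ := exists_between hb
    rw [hreg.quantile_lt_iff] at hc1
    filter_upwards [hw'.eventually_lt (hcdf c) hc1, hWe, hw'.eventually_const_lt hw]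
      with p hp hWp hp0
    refine lt_of_le_of_lt (not_lt.1 fun hlt => ?_) hcb
    exact absurd (Particles.measureReal_lt_of_lt_resampleAt hh hWp hp0 hlt) (not_lt.2 hp.le)

end

/-! ### The mutation step -/

theorem RosenblattRegular.continuous {d : ℕ} {κ : Cube d → CondFamily d}
    (hF : RosenblattRegular κ) : Continuous fun p : Cube d × Cube d => rosenblatt (κ p.1) p.2 := by
  obtain ⟨C, r, hr, -, h⟩ := hF.holder
  exact h.continuous hr

theorem RosenblattRegular.isRegularLaw {d : ℕ} {κ : Cube d → CondFamily d}
    (hF : RosenblattRegular κ) {x' : Cube d} {i : Fin d} (hm : IsMarkovKernel (κ x' i))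
    (y : InitialCoords i) : IsRegularLaw (κ x' i y) := by
  refine ⟨inferInstance, ⟨fun s => ?_⟩, fun a b hab => ?_⟩
  · obtain ⟨p, -, hp⟩ := hF.bounded_density i
    rw [(hp x' y).2]
    exact withDensity_absolutelyContinuous _ _ (measure_singleton s)
  · let x : Cube d := fun j => if hj : j < i then y ⟨j, hj⟩ else uiZero
    have h1 : ∀ s, rosenblatt (κ x') (Function.update x i s) i = (κ x' i y).real (Iic s) := by
      intro s
      have h2 : initialCoords i (Function.update x i s) = y := by
        funext j
        have hj : j.1 ≠ i := j.2.ne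
        simp only [initialCoords, Function.update_of_ne hj, x, dif_pos j.2]
      simp only [rosenblatt, h2, Function.update_self]
    have h2 := hF.strictMono i x' x hab
    simp only [h1] at h2
    exact h2

theorem continuous_fin_tail {d : ℕ} : Continuous fun u : Cube (d + 1) => (Fin.tail u : Cube d) :=
  continuous_pi fun i => continuous_apply i.succ

theorem map_lebCube_succ (d : ℕ) :
    (lebCube (d + 1)).map (fun u => (u 0, (Fin.tail u : Cube d))) = lebUI.prod (lebCube d) :=
  (measurePreserving_piFinSuccAbove (fun _ : Fin (d + 1) => lebUI) 0).map_eq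

section

variable {d : ℕ} {H : C(unitInterval, Fin d → unitInterval)}

/-- The limiting step of the algorithm: the first uniform coordinate becomes a point of law `ν` on
the Hilbert axis, the other `d` a draw from the transition kernel at its image under `H`. -/
theorem map_lebCube_quantile_rosenblattInv {ν : Measure UI} (hν : IsRegularLaw ν)
    {m : Kernel (Cube d) (Cube d)} [IsMarkovKernel m] {κ : Cube d → CondFamily d}
    (hκ : ∀ x', IsConditionalFamily (m x') (κ x')) (hF : RosenblattRegular κ) :
    (lebCube (d + 1)).map (fun u => (quantile ν (u 0),
      rosenblattInv (κ (toCube (H (inclUI (quantile ν (u 0)))))) (Fin.tail u))) =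
      ν ⊗ₘ hilbertKernel H m := by
  have hreg : ∀ x' i y, IsRegularLaw (κ x' i y) := fun x' i y => hF.isRegularLaw (hκ x' i).1 y
  have hFc := continuous_rosenblattInv hF.continuous hreg
  have hprob := hν.prob
  have : IsMarkovKernel (hilbertKernel H m) := by unfold hilbertKernel; infer_instance
  have hg : Measurable fun p : UI × Cube d =>
      rosenblattInv (κ (toCube (H (inclUI p.1)))) p.2 :=
    hFc.measurable.comp (((measurable_toCube_hilbert H).comp measurable_fst).prodMk measurable_snd)
  have h1 := map_prod_eq_compProd (μ := ν) (ν := lebCube d) (κ := hilbertKernel H m) hg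
    (ae_of_all _ fun s => map_rosenblattInv (hκ (toCube (H (inclUI s)))) (hreg _)
      (hFc.comp (continuous_const.prodMk continuous_id)).measurable)
  have h2 : (lebUI.prod (lebCube d)).map (Prod.map (quantile ν) id) = ν.prod (lebCube d) := by
    rw [← Measure.map_prod_map _ _ hν.measurable_quantile measurable_id, hν.map_quantile,
      Measure.map_id]
  have htail : Measurable fun u : Cube (d + 1) => (u 0, (Fin.tail u : Cube d)) :=
    (measurable_pi_apply 0).prodMk continuous_fin_tail.measurable
  rw [← h1, ← h2, ← map_lebCube_succ, Measure.map_map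
    (hν.measurable_quantile.prodMap measurable_id) htail, Measure.map_map
    (measurable_fst.prodMk hg) ((hν.measurable_quantile.prodMap measurable_id).comp htail)]
  rfl

variable {h : Cube d → UI} {P : (N : ℕ) → Particles d N} {Q : Measure (Cube d)}
  [IsProbabilityMeasure Q] {p : Cube d → ℝ≥0}

/-- Convergence of the resampled and mutated particles. -/
theorem tendsto_sum_resample_mutate (hd : 1 ≤ d) (hH : IsHilbertCurve H)
    (hh : IsHilbertPseudoInverse H h) (hp : Measurable p) (hpos : ∀ x, 0 < p x)
    (hQ : Q = (lebCube d).withDensity (fun x => (p x : ℝ≥0∞)))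
    (hP : WeakLim (fun N => (P N).measure) Q) (hW : ∀ᶠ N in atTop, ∑ k, (P N).W k = 1)
    {m : Kernel (Cube d) (Cube d)} [IsMarkovKernel m] {κ : Cube d → CondFamily d}
    (hκ : ∀ x', IsConditionalFamily (m x') (κ x')) (hF : RosenblattRegular κ)
    {u : (N : ℕ) → Fin N → Cube (d + 1)}
    (hu : Tendsto (fun N => discrepancy (u N)) atTop (𝓝 0))
    {ψ : UI × Cube d × Cube d → ℝ} (hψ : Continuous ψ) {C : ℝ} (hC : ∀ z, |ψ z| ≤ C) :
    Tendsto (fun N : ℕ => (N : ℝ)⁻¹ * ∑ n, ψ (h ((P N).resample h (fun n => u N n 0) n),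
        (P N).resample h (fun n => u N n 0) n,
        rosenblattInv (κ ((P N).resample h (fun n => u N n 0) n)) (Fin.tail (u N n)))) atTop
      (𝓝 (∫ z, ψ (z.1, toCube (H (inclUI z.1)), z.2) ∂(Q.map h ⊗ₘ hilbertKernel H m))) := by
  have hreg := hH.isRegularLaw_map hd hh hp hpos hQ
  have hregκ : ∀ x' i y, IsRegularLaw (κ x' i y) := fun x' i y => hF.isRegularLaw (hκ x' i).1 y
  have hFc := continuous_rosenblattInv hF.continuous hregκ
  have hc : ∀ᵐ x ∂Q, ContinuousAt h x := by
    refine (ae_ne_dyadic fun i r => ?_).mono fun x hx => hH.continuousAt_pseudoInverse hd hh hx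
    rw [hQ]
    exact withDensity_absolutelyContinuous _ _ (lebCube_hyperplane i r)
  let q := quantile (Q.map h)
  let Y : UI → Cube d := fun s => toCube (H (inclUI s))
  have hY : Measurable Y := measurable_toCube_hilbert H
  have h0 : (lebCube (d + 1)).map (fun u => u 0) = lebUI :=
    (measurePreserving_eval (fun _ : Fin (d + 1) => lebUI) 0).map_eq
  -- The two null exceptions to continuous convergence: `w = 0` for the resampling map, and
  -- quantiles where a coordinate of `H` equals `1`.
  have hgood : ∀ᵐ v ∂lebCube (d + 1), (0 : ℝ) < (v 0 : UI) ∧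
      ∀ i, ((H (inclUI (q (v 0))) i : unitInterval) : ℝ) < 1 := by
    have h1 : ∀ᵐ w ∂lebUI, (0 : ℝ) < (w : UI) ∧
        ∀ i, ((H (inclUI (q w)) i : unitInterval) : ℝ) < 1 := by
      refine Eventually.and ?_ ?_
      · have : ∀ᵐ w ∂lebUI, w ≠ uiZero := by simp [ae_iff]
        filter_upwards [this] with w hw
        exact lt_of_le_of_ne w.2.1 fun h2 => hw (Subtype.ext h2.symm)
      · have h2 := hh.ae_lt_one Q
        rw [← hreg.map_quantile] at h2
        exact ae_of_ae_map hreg.measurable_quantile.aemeasurable h2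
    rw [← h0] at h1
    exact ae_of_ae_map (measurable_pi_apply 0).aemeasurable h1
  have key := (weakLim_of_discrepancy hu).tendsto_integral
    (f := fun N v => ψ (h ((P N).resampleAt h (v 0)), (P N).resampleAt h (v 0),
      rosenblattInv (κ ((P N).resampleAt h (v 0))) (Fin.tail v)))
    (g := fun v => ψ (q (v 0), Y (q (v 0)), rosenblattInv (κ (Y (q (v 0)))) (Fin.tail v)))
    (C := C) (fun N => aestronglyMeasurable_empirical _ _) (fun N v => hC _) ?_
  · have hlim : ∫ v, ψ (q (v 0), Y (q (v 0)), rosenblattInv (κ (Y (q (v 0)))) (Fin.tail v))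
        ∂lebCube (d + 1) =
        ∫ z, ψ (z.1, toCube (H (inclUI z.1)), z.2) ∂(Q.map h ⊗ₘ hilbertKernel H m) := by
      rw [← map_lebCube_quantile_rosenblattInv hreg hκ hF, integral_map]
      · have hq0 : Measurable fun u : Cube (d + 1) => q (u 0) :=
          hreg.measurable_quantile.comp (measurable_pi_apply 0)
        exact (hq0.prodMk (hFc.measurable.comp
          ((hY.comp hq0).prodMk continuous_fin_tail.measurable))).aemeasurable
      · exact (hψ.measurable.comp (measurable_fst.prodMk
          ((hY.comp measurable_fst).prodMk measurable_snd))).aestronglyMeasurable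
    rw [hlim] at key
    refine key.congr' ?_
    filter_upwards [hW] with N hN
    simp_rw [integral_empirical, Particles.resample_eq_resampleAt h hN]
  · filter_upwards [hgood] with v hv
    have h1 : Tendsto (fun z : ℕ × Cube (d + 1) => h ((P z.1).resampleAt h (z.2 0)))
        (atTop ×ˢ 𝓝 v) (𝓝 (q (v 0))) :=
      (tendsto_resampleAt hP hh.measurable hc hreg hW hv.1).comp
        (tendsto_id.prodMap ((continuous_apply 0).tendsto v))
    -- Convergence is known for the Hilbert index; the point itself is recovered from `H (h x) = x`.
    have h2 : Tendsto (fun z : ℕ × Cube (d + 1) => (P z.1).resampleAt h (z.2 0))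
        (atTop ×ˢ 𝓝 v) (𝓝 (Y (q (v 0)))) :=
      ((continuousAt_toCube_hilbert hv.2).tendsto.comp h1).congr fun z => hh.toCube_apply _
    have h3 : Tendsto (fun z : ℕ × Cube (d + 1) => (Fin.tail z.2 : Cube d))
        (atTop ×ˢ 𝓝 v) (𝓝 (Fin.tail v)) := (continuous_fin_tail.tendsto v).comp tendsto_snd
    exact (hψ.tendsto _).comp (h1.prodMk_nhds (h2.prodMk_nhds
      ((hFc.tendsto (Y (q (v 0)), Fin.tail v)).comp (h2.prodMk_nhds h3))))

theorem measure_hyperplane_of_isConditionalFamily {π : Measure (Cube d)} [IsProbabilityMeasure π]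
    {κ : CondFamily d} (hπ : IsConditionalFamily π κ) (hκ : ∀ i y, IsRegularLaw (κ i y))
    (i : Fin d) (r : ℝ) : π {x | (x i : ℝ) = r} = 0 := by
  have hm := (hπ i).1
  have hs : {s : UI | (s : ℝ) = r}.Subsingleton := fun s hs t ht => Subtype.ext (hs.trans ht.symm)
  have h1 := DFunLike.congr_fun (hπ i).2 (Prod.snd ⁻¹' {s : UI | (s : ℝ) = r})
  have hms : MeasurableSet (Prod.snd ⁻¹' {s : UI | (s : ℝ) = r} : Set (InitialCoords i × UI)) :=
    measurable_snd hs.measurableSet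
  have hprob : IsProbabilityMeasure (π.map (initialCoords i)) :=
    Measure.isProbabilityMeasure_map (measurable_initialCoords i).aemeasurable
  rw [Measure.map_apply ((measurable_initialCoords i).prodMk (measurable_pi_apply i)) hms,
    Measure.compProd_apply hms] at h1
  refine h1.trans ?_
  rw [lintegral_eq_zero_iff' (Kernel.measurable_kernel_prodMk_left hms).aemeasurable]
  refine ae_of_all _ fun y => ?_
  have := (hκ i y).noAtoms
  exact hs.measure_zero (κ i y)

theorem continuous_joinPoint : Continuous (joinPoint (d := d)) :=
  continuous_pi fun i => Fin.cases (by simpa [joinPoint] using continuous_fst)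
    (fun j => (continuous_apply j).comp continuous_snd) i

theorem map_joinPoint_hyperplane {ν : Measure UI} (hν : IsRegularLaw ν)
    {m : Kernel (Cube d) (Cube d)} [IsMarkovKernel m] {κ : Cube d → CondFamily d}
    (hκ : ∀ x', IsConditionalFamily (m x') (κ x')) (hF : RosenblattRegular κ)
    (i : Fin (d + 1)) (r : ℝ) :
    (ν ⊗ₘ hilbertKernel H m).map joinPoint {x | (x i : ℝ) = r} = 0 := by
  have : IsMarkovKernel (hilbertKernel H m) := by unfold hilbertKernel; infer_instance
  have hprob := hν.prob
  have := hν.noAtoms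
  have hms : ∀ (n : ℕ) (j : Fin n), MeasurableSet {x : Cube n | (x j : ℝ) = r} := fun n j =>
    measurableSet_eq_fun (measurable_subtype_coe.comp (measurable_pi_apply j)) measurable_const
  rw [Measure.map_apply continuous_joinPoint.measurable (hms _ i), Measure.compProd_apply
    (continuous_joinPoint.measurable (hms _ i))]
  refine Fin.cases ?_ (fun j => ?_) i
  · have hs : {s : UI | (s : ℝ) = r}.Subsingleton :=
      fun s hs t ht => Subtype.ext (hs.trans ht.symm)
    have h1 : ∀ᵐ s ∂ν, s ∉ {s : UI | (s : ℝ) = r} := by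
      simp only [ae_iff, not_not]
      exact hs.measure_zero ν
    rw [lintegral_congr_ae (g := fun _ => 0) (h1.mono fun s hs => ?_), lintegral_zero]
    have : Prod.mk s ⁻¹' (joinPoint ⁻¹' {x : Cube (d + 1) | (x 0 : ℝ) = r}) = ∅ := by
      ext x
      simpa [joinPoint] using hs
    rw [this, measure_empty]
  · rw [lintegral_congr (g := fun _ => 0) (fun s => ?_), lintegral_zero]
    exact measure_hyperplane_of_isConditionalFamily (hκ (toCube (H (inclUI s))))
      (fun i y => hF.isRegularLaw (hκ _ i).1 y) j r

end

/-! ### Recursion for the filtering distributions -/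

namespace FeynmanKac

variable {d : ℕ} (M : FeynmanKac d)

instance : IsProbabilityMeasure M.m₀ := M.isProbabilityMeasure_m₀

instance (t : ℕ) : IsMarkovKernel (M.m t) := M.isMarkovKernel_m t

theorem measurable_snoc {t : ℕ} : Measurable fun p : (Fin t → Cube d) × Cube d =>
    (Fin.snoc p.1 p.2 : Fin (t + 1) → Cube d) := by
  refine measurable_pi_lambda _ fun i => Fin.lastCases ?_ (fun j => ?_) i
  · simpa using measurable_snd
  · have h : Measurable fun p : (Fin t → Cube d) × Cube d => p.1 j :=
      (measurable_pi_apply j).comp measurable_fst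
    simpa using h

instance isProbabilityMeasure_pathLaw (t : ℕ) : IsProbabilityMeasure (M.pathLaw t) := by
  induction t with
  | zero =>
    exact Measure.isProbabilityMeasure_map (by fun_prop)
  | succ t ih =>
    exact Measure.isProbabilityMeasure_map measurable_snoc.aemeasurable

/-- The unnormalised filtering distribution. -/
noncomputable def unnormalized (t : ℕ) : Measure (Cube d) :=
  ((M.pathLaw t).withDensity (fun z => (M.pathPotential t z : ℝ≥0∞))).map (fun z => z (Fin.last t))

instance (t : ℕ) : SFinite (M.unnormalized t) := by unfold unnormalized; infer_instance

theorem Q_eq (t : ℕ) : M.Q t = (M.Z t)⁻¹ • M.unnormalized t := rfl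

theorem unnormalized_univ (t : ℕ) : M.unnormalized t univ = M.Z t := by
  rw [unnormalized, Measure.map_apply (measurable_pi_apply _) MeasurableSet.univ, preimage_univ,
    withDensity_apply _ MeasurableSet.univ, Measure.restrict_univ, Z]

variable {M}

theorem measurable_pathPotential {t : ℕ} (hG₀ : Measurable M.G₀)
    (hG : ∀ s, 1 ≤ s → s ≤ t → Measurable fun p : Cube d × Cube d => M.G s p.1 p.2) :
    Measurable (M.pathPotential t) := by
  refine (hG₀.comp (measurable_pi_apply 0)).mul (Finset.measurable_prod _ fun s _ => ?_)
  have h : Measurable fun z : Fin (t + 1) → Cube d => (z s.castSucc, z s.succ) :=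
    (measurable_pi_apply s.castSucc).prodMk (measurable_pi_apply s.succ)
  exact (hG (s + 1) (Nat.le_add_left 1 s) s.2).comp h

theorem pathPotential_snoc (t : ℕ) (z : Fin (t + 1) → Cube d) (x : Cube d) :
    M.pathPotential (t + 1) (Fin.snoc z x : Fin (t + 2) → Cube d) =
      M.pathPotential t z * M.G (t + 1) (z (Fin.last t)) x := by
  have h0 : (Fin.snoc z x : Fin (t + 2) → Cube d) 0 = z 0 := Fin.snoc_castSucc (i := 0) ..
  have hc : ∀ i : Fin (t + 1), (Fin.snoc z x : Fin (t + 2) → Cube d) i.castSucc = z i :=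
    fun i => Fin.snoc_castSucc ..
  have hl : (Fin.snoc z x : Fin (t + 2) → Cube d) (Fin.last (t + 1)) = x := Fin.snoc_last ..
  simp only [pathPotential, Fin.prod_univ_castSucc, h0, hc, Fin.succ_castSucc, Fin.succ_last, hl,
    Fin.val_castSucc, Fin.val_last, mul_assoc]

theorem unnormalized_zero (hG₀ : Measurable M.G₀) :
    M.unnormalized 0 = M.m₀.withDensity fun x => (M.G₀ x : ℝ≥0∞) := by
  have hm : Measurable fun (x : Cube d) (_ : Fin 1) => x := by fun_prop
  have hp : Measurable fun z : Fin 1 → Cube d => (M.pathPotential 0 z : ℝ≥0∞) :=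
    (measurable_pathPotential hG₀ (fun s h1 h2 => by omega)).coe_nnreal_ennreal
  have hl : Measurable fun z : Fin 1 → Cube d => z (Fin.last 0) := measurable_pi_apply _
  refine Measure.ext_of_lintegral _ fun f hf => ?_
  have hfl : Measurable fun z : Fin 1 → Cube d => f (z (Fin.last 0)) := hf.comp hl
  rw [unnormalized, lintegral_map hf hl, lintegral_withDensity_eq_lintegral_mul _ hp hfl,
    lintegral_withDensity_eq_lintegral_mul _ hG₀.coe_nnreal_ennreal hf, pathLaw,
    lintegral_map (hp.mul hfl) hm]
  simp [pathPotential]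

/-- Markov property: once the last state is integrated out, the remaining factor depends on the path
only through its current endpoint. -/
theorem unnormalized_succ {t : ℕ} (hG₀ : Measurable M.G₀)
    (hG : ∀ s, 1 ≤ s → s ≤ t + 1 → Measurable fun p : Cube d × Cube d => M.G s p.1 p.2) :
    M.unnormalized (t + 1) = ((M.unnormalized t ⊗ₘ M.m (t + 1)).withDensity
      fun p => (M.G (t + 1) p.1 p.2 : ℝ≥0∞)).map Prod.snd := by
  have hp1 : Measurable fun z : Fin (t + 2) → Cube d => (M.pathPotential (t + 1) z : ℝ≥0∞) :=
    (measurable_pathPotential hG₀ hG).coe_nnreal_ennreal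
  have hp : Measurable fun z : Fin (t + 1) → Cube d => (M.pathPotential t z : ℝ≥0∞) :=
    (measurable_pathPotential hG₀ fun s h1 h2 => hG s h1 (by omega)).coe_nnreal_ennreal
  have hGt : Measurable fun p : Cube d × Cube d => (M.G (t + 1) p.1 p.2 : ℝ≥0∞) :=
    (hG (t + 1) (by omega) le_rfl).coe_nnreal_ennreal
  have hlast : ∀ n, Measurable fun z : Fin (n + 1) → Cube d => z (Fin.last n) :=
    fun n => measurable_pi_apply _
  refine Measure.ext_of_lintegral _ fun f hf => ?_
  have hGf : Measurable fun p : Cube d × Cube d => (M.G (t + 1) p.1 p.2 : ℝ≥0∞) * f p.2 :=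
    hGt.mul (hf.comp measurable_snd)
  have hin : Measurable fun x' => ∫⁻ x, M.G (t + 1) x' x * f x ∂M.m (t + 1) x' :=
    Measurable.lintegral_kernel_prod_right' hGf
  have hL : ∫⁻ x, f x ∂M.unnormalized (t + 1) =
      ∫⁻ z, M.pathPotential t z * ∫⁻ x, M.G (t + 1) (z (Fin.last t)) x * f x
        ∂M.m (t + 1) (z (Fin.last t)) ∂M.pathLaw t := by
    have hint : Measurable fun z : Fin (t + 2) → Cube d =>
        (M.pathPotential (t + 1) z : ℝ≥0∞) * f (z (Fin.last (t + 1))) :=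
      hp1.mul (hf.comp (hlast _))
    have hfl : Measurable fun z : Fin (t + 2) → Cube d => f (z (Fin.last (t + 1))) :=
      hf.comp (hlast _)
    rw [unnormalized, lintegral_map hf (hlast _),
      lintegral_withDensity_eq_lintegral_mul _ hp1 hfl]
    simp only [Pi.mul_apply]
    have hints : Measurable fun p : (Fin (t + 1) → Cube d) × Cube d =>
        (M.pathPotential (t + 1) (Fin.snoc p.1 p.2 : Fin (t + 2) → Cube d) : ℝ≥0∞) *
          f ((Fin.snoc p.1 p.2 : Fin (t + 2) → Cube d) (Fin.last (t + 1))) :=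
      hint.comp measurable_snoc
    rw [pathLaw, lintegral_map hint measurable_snoc, Measure.lintegral_compProd hints]
    refine lintegral_congr fun z => ?_
    rw [← lintegral_const_mul' _ _ ENNReal.coe_ne_top, Kernel.comap_apply]
    refine lintegral_congr fun x => ?_
    rw [pathPotential_snoc, Fin.snoc_last]
    push_cast
    ring
  have hinl : Measurable fun z : Fin (t + 1) → Cube d =>
      ∫⁻ x, M.G (t + 1) (z (Fin.last t)) x * f x ∂M.m (t + 1) (z (Fin.last t)) :=
    hin.comp (hlast _)
  have hf2 : Measurable fun p : Cube d × Cube d => f p.2 := hf.comp measurable_snd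
  rw [hL, lintegral_map hf measurable_snd, lintegral_withDensity_eq_lintegral_mul _ hGt hf2]
  simp only [Pi.mul_apply]
  rw [Measure.lintegral_compProd hGf, unnormalized,
    lintegral_map hin (hlast _), lintegral_withDensity_eq_lintegral_mul _ hp hinl]
  rfl

/-- If `Z = 0` the unnormalised measure vanishes; if `Z = ∞` its inverse is zero. Either way `Q`
would be the zero measure. -/
theorem Z_ne_zero_and_ne_top {t : ℕ} (h : M.Q t ≠ 0) : M.Z t ≠ 0 ∧ M.Z t ≠ ∞ := by
  constructor
  · intro h0
    refine h ?_
    rw [Q_eq, Measure.measure_univ_eq_zero.1 ((M.unnormalized_univ t).trans h0), smul_zero]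
  · intro h0
    refine h ?_
    rw [Q_eq, h0, ENNReal.inv_top, zero_smul]

theorem isProbabilityMeasure_Q {t : ℕ} (h : M.Q t ≠ 0) : IsProbabilityMeasure (M.Q t) := by
  obtain ⟨h1, h2⟩ := Z_ne_zero_and_ne_top h
  constructor
  rw [Q_eq, Measure.smul_apply, unnormalized_univ, smul_eq_mul, ENNReal.inv_mul_cancel h1 h2]

/-- The map by `id` gives the shape shared with `Q_succ`, so that `integral_reweighted` serves both.
-/
theorem Q_zero (hG₀ : Measurable M.G₀) :
    M.Q 0 = (∫⁻ x, M.G₀ x ∂M.m₀)⁻¹ • (M.m₀.withDensity fun x => (M.G₀ x : ℝ≥0∞)).map id := by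
  rw [Measure.map_id, Q_eq, ← unnormalized_univ, unnormalized_zero hG₀,
    withDensity_apply _ MeasurableSet.univ, Measure.restrict_univ]

theorem Q_succ {t : ℕ} (hG₀ : Measurable M.G₀)
    (hG : ∀ s, 1 ≤ s → s ≤ t + 1 → Measurable fun p : Cube d × Cube d => M.G s p.1 p.2)
    (h : M.Q t ≠ 0) :
    M.Q (t + 1) = (∫⁻ p, M.G (t + 1) p.1 p.2 ∂(M.Q t ⊗ₘ M.m (t + 1)))⁻¹ •
      ((M.Q t ⊗ₘ M.m (t + 1)).withDensity fun p => (M.G (t + 1) p.1 p.2 : ℝ≥0∞)).map Prod.snd := by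
  obtain ⟨h1, h2⟩ := Z_ne_zero_and_ne_top h
  have hprob := isProbabilityMeasure_Q h
  have hu : M.unnormalized t = M.Z t • M.Q t := by
    rw [Q_eq, smul_smul, ENNReal.mul_inv_cancel h1 h2, one_smul]
  have hs : M.unnormalized (t + 1) = M.Z t • ((M.Q t ⊗ₘ M.m (t + 1)).withDensity
      fun p => (M.G (t + 1) p.1 p.2 : ℝ≥0∞)).map Prod.snd := by
    rw [unnormalized_succ hG₀ hG, hu, Measure.compProd_smul_left, withDensity_smul_measure,
      Measure.map_smul]
  have hZ : M.Z (t + 1) = M.Z t * ∫⁻ p, M.G (t + 1) p.1 p.2 ∂(M.Q t ⊗ₘ M.m (t + 1)) := by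
    rw [← unnormalized_univ, hs, Measure.smul_apply, Measure.map_apply measurable_snd
      MeasurableSet.univ, preimage_univ, withDensity_apply _ MeasurableSet.univ,
      Measure.restrict_univ, smul_eq_mul]
  rw [Q_eq, hs, hZ, smul_smul, ENNReal.mul_inv (Or.inl h1) (Or.inl h2), mul_right_comm,
    ENNReal.inv_mul_cancel h1 h2, one_mul]

end FeynmanKac

/-! ### Reweighting -/

theorem integral_reweighted {Y X : Type*} [MeasurableSpace Y] [MeasurableSpace X] {ν : Measure Y}
    {G : Y → ℝ≥0} (hG : Measurable G) {f : Y → X} (hf : Measurable f) {φ : X → ℝ}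
    (hφ : Measurable φ) :
    ∫ x, φ x ∂((∫⁻ y, G y ∂ν)⁻¹ • (ν.withDensity fun y => (G y : ℝ≥0∞)).map f) =
      (∫ y, (G y : ℝ) * φ (f y) ∂ν) / ∫ y, (G y : ℝ) ∂ν := by
  have h1 : ∫ y, (G y : ℝ) ∂ν = (∫⁻ y, G y ∂ν).toReal := by
    rw [← integral_toReal hG.coe_nnreal_ennreal.aemeasurable (ae_of_all _ fun y => by simp)]
    simp
  rw [integral_smul_measure, integral_map hf.aemeasurable hφ.aestronglyMeasurable,
    integral_withDensity_eq_integral_smul hG, h1, ENNReal.toReal_inv, smul_eq_mul, div_eq_inv_mul]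
  rfl

theorem integral_weight_pos {Y X : Type*} [MeasurableSpace Y] [MeasurableSpace X] {ν : Measure Y}
    {G : Y → ℝ≥0} (hG : Measurable G) {f : Y → X}
    (h0 : (∫⁻ y, G y ∂ν)⁻¹ • (ν.withDensity fun y => (G y : ℝ≥0∞)).map f ≠ 0) :
    0 < ∫ y, (G y : ℝ) ∂ν := by
  have h1 : ∫ y, (G y : ℝ) ∂ν = (∫⁻ y, G y ∂ν).toReal := by
    rw [← integral_toReal hG.coe_nnreal_ennreal.aemeasurable (ae_of_all _ fun y => by simp)]
    simp
  rw [h1]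
  refine ENNReal.toReal_pos (fun h2 => h0 ?_) (fun h2 => h0 ?_)
  · have : ν.withDensity (fun y => (G y : ℝ≥0∞)) = 0 := by
      rw [← Measure.measure_univ_eq_zero, withDensity_apply _ MeasurableSet.univ,
        Measure.restrict_univ, h2]
    rw [this, Measure.map_zero, smul_zero]
  · rw [h2, ENNReal.inv_top, zero_smul]

theorem sum_normalizeWeights {N : ℕ} {w : Fin N → ℝ≥0} (hw : ∑ k, w k ≠ 0) :
    ∑ k, normalizeWeights w k = 1 := by
  simp only [normalizeWeights]
  rw [← Finset.sum_div, div_self hw]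

/-- Convergence of self-normalised sums. -/
theorem weakLim_normalizeWeights {d : ℕ} {x : (N : ℕ) → Fin N → Cube d}
    {w : (N : ℕ) → Fin N → ℝ≥0} {Q : Measure (Cube d)} {A : (Cube d → ℝ) → ℝ}
    (hA : ∀ φ : Cube d → ℝ, Continuous φ → (∃ C, ∀ x, |φ x| ≤ C) →
      Tendsto (fun N : ℕ => (N : ℝ)⁻¹ * ∑ n, (w N n : ℝ) * φ (x N n)) atTop (𝓝 (A φ)))
    (h1 : 0 < A fun _ => 1)
    (hQ : ∀ φ : Cube d → ℝ, Measurable φ → ∫ x, φ x ∂Q = A φ / A fun _ => 1) :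
    WeakLim (fun N => (Particles.mk (x N) (normalizeWeights (w N))).measure) Q ∧
      ∀ᶠ N in atTop, ∑ k, normalizeWeights (w N) k = 1 := by
  have hone := hA (fun _ => 1) continuous_const ⟨1, fun _ => by simp⟩
  have hpos := hone.eventually_const_lt h1
  refine ⟨fun φ hφ hC => ?_, ?_⟩
  · rw [hQ φ hφ.measurable]
    refine ((hA φ hφ hC).div hone h1.ne').congr' ?_
    filter_upwards [eventually_gt_atTop 0] with N hN
    have hN' : (N : ℝ)⁻¹ ≠ 0 := by positivity
    rw [Particles.integral_measure, Pi.div_apply, mul_div_mul_left _ _ hN', Finset.sum_div]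
    refine Finset.sum_congr rfl fun n _ => ?_
    simp only [normalizeWeights, NNReal.coe_div, NNReal.coe_sum, mul_one]
    ring
  · filter_upwards [hpos] with N hN
    refine sum_normalizeWeights fun h0 => absurd hN ?_
    have : ∑ n, (w N n : ℝ) = 0 := by exact_mod_cast h0
    simp [this]

/-! ### Convergence of the SQMC algorithm -/

/-- Since `H` undoes `h`, passing through the Hilbert axis loses nothing; this carries the limit
back to the cube for reweighting. -/
theorem map_compProd_hilbertKernel {d : ℕ} {H : C(unitInterval, Fin d → unitInterval)}
    {h : Cube d → UI} (hh : IsHilbertPseudoInverse H h) (Q : Measure (Cube d))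
    [IsProbabilityMeasure Q] (m : Kernel (Cube d) (Cube d)) [IsMarkovKernel m] :
    (Q.map h ⊗ₘ hilbertKernel H m).map (fun z => (toCube (H (inclUI z.1)), z.2)) = Q ⊗ₘ m := by
  have : IsMarkovKernel (hilbertKernel H m) := by unfold hilbertKernel; infer_instance
  have : IsProbabilityMeasure (Q.map h) :=
    Measure.isProbabilityMeasure_map hh.measurable.aemeasurable
  have hm : Measurable fun z : UI × Cube d => (toCube (H (inclUI z.1)), z.2) :=
    ((measurable_toCube_hilbert H).comp measurable_fst).prodMk measurable_snd
  ext s hs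
  rw [Measure.map_apply hm hs, Measure.compProd_apply (hm hs), Measure.compProd_apply hs,
    lintegral_map (Kernel.measurable_kernel_prodMk_left (hm hs)) hh.measurable]
  refine lintegral_congr fun x => ?_
  rw [hilbertKernel, Kernel.comap_apply, hh.toCube_apply]
  congr 1
  ext y
  simp only [mem_preimage, hh.toCube_apply]

section

variable {d : ℕ} {H : C(unitInterval, Fin d → unitInterval)} {h : Cube d → UI} {T : ℕ}
  {M : FeynmanKac d} {κ₀ : CondFamily d} {κ : ℕ → Cube d → CondFamily d}
  {u₀ : (N : ℕ) → Fin N → Cube d} {u : (N : ℕ) → ℕ → Fin N → Cube (d + 1)}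

theorem ne_zero_of_density {Q : Measure (Cube d)} {p : Cube d → ℝ≥0} (hp : Measurable p)
    (hpos : ∀ x, 0 < p x) (hQ : Q = (lebCube d).withDensity (fun x => (p x : ℝ≥0∞))) : Q ≠ 0 := by
  rintro rfl
  exact withDensity_pos hp hpos MeasurableSet.univ (by simp)
    (by rw [← hQ]; simp)

theorem abs_mul_le_of_le {g : ℝ≥0} {C : ℝ≥0} {x C' : ℝ} (hg : g ≤ C) (hx : |x| ≤ C') :
    |(g : ℝ) * x| ≤ C * C' := by
  rw [abs_mul, abs_of_nonneg g.coe_nonneg]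
  exact mul_le_mul (by exact_mod_cast hg) hx (abs_nonneg _) C.coe_nonneg

theorem weakLim_sqmc_zero (hκ₀ : IsConditionalFamily M.m₀ κ₀)
    (hu₀ : Tendsto (fun N => discrepancy (u₀ N)) atTop (𝓝 0)) (hG₀ : Continuous M.G₀)
    {C : ℝ≥0} (hC : ∀ x, M.G₀ x ≤ C) (hF₀ : RosenblattRegular (fun _ : Cube d => κ₀))
    (hQ : M.Q 0 ≠ 0) :
    WeakLim (fun N => (sqmc M h κ₀ κ (u₀ N) (u N) 0).measure) (M.Q 0) ∧
      ∀ᶠ N in atTop, ∑ k, (sqmc M h κ₀ κ (u₀ N) (u N) 0).W k = 1 := by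
  have hreg : ∀ i y, IsRegularLaw (κ₀ i y) := fun i y =>
    hF₀.isRegularLaw (x' := fun _ => uiZero) (hκ₀ i).1 y
  have hFc : Continuous (rosenblattInv κ₀) :=
    (continuous_rosenblattInv hF₀.continuous fun _ => hreg).comp
      ((continuous_const (y := fun _ => uiZero)).prodMk continuous_id)
  have hQ0 := FeynmanKac.Q_zero (M := M) hG₀.measurable
  refine weakLim_normalizeWeights (A := fun φ => ∫ x, (M.G₀ x : ℝ) * φ x ∂M.m₀) ?_ ?_ ?_
  · rintro φ hφ ⟨C', hC'⟩
    have hψ : Continuous fun x => (M.G₀ x : ℝ) * φ x := (NNReal.continuous_coe.comp hG₀).mul hφ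
    have key := weakLim_of_discrepancy hu₀ (fun v => (M.G₀ (rosenblattInv κ₀ v) : ℝ) *
      φ (rosenblattInv κ₀ v)) (hψ.comp hFc) ⟨C * C', fun v => abs_mul_le_of_le (hC _) (hC' _)⟩
    rw [← map_rosenblattInv hκ₀ hreg hFc.measurable, integral_map hFc.measurable.aemeasurable
      hψ.measurable.aestronglyMeasurable]
    simpa only [integral_empirical] using key
  · simp only [mul_one]
    exact integral_weight_pos hG₀.measurable (f := id) (hQ0 ▸ hQ)
  · intro φ hφ
    rw [hQ0, integral_reweighted hG₀.measurable measurable_id hφ]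
    simp only [mul_one, id]

theorem weakLim_sqmc_succ (hd : 1 ≤ d) (hH : IsHilbertCurve H) (hh : IsHilbertPseudoInverse H h)
    {t : ℕ} (hκ : ∀ x', IsConditionalFamily (M.m (t + 1) x') (κ (t + 1) x'))
    (hu : Tendsto (fun N => discrepancy (u N (t + 1))) atTop (𝓝 0)) (hG₀ : Measurable M.G₀)
    (hGm : ∀ s, 1 ≤ s → s ≤ t + 1 → Measurable fun p : Cube d × Cube d => M.G s p.1 p.2)
    (hG : Continuous fun p : Cube d × Cube d => M.G (t + 1) p.1 p.2)
    {C : ℝ≥0} (hC : ∀ x' x, M.G (t + 1) x' x ≤ C) (hF : RosenblattRegular (κ (t + 1)))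
    {p : Cube d → ℝ≥0} (hp : Measurable p) (hpos : ∀ x, 0 < p x)
    (hQ : M.Q t = (lebCube d).withDensity (fun x => (p x : ℝ≥0∞))) (hQ' : M.Q (t + 1) ≠ 0)
    (hP : WeakLim (fun N => (sqmc M h κ₀ κ (u₀ N) (u N) t).measure) (M.Q t))
    (hW : ∀ᶠ N in atTop, ∑ k, (sqmc M h κ₀ κ (u₀ N) (u N) t).W k = 1) :
    WeakLim (fun N => (sqmc M h κ₀ κ (u₀ N) (u N) (t + 1)).measure) (M.Q (t + 1)) ∧
      ∀ᶠ N in atTop, ∑ k, (sqmc M h κ₀ κ (u₀ N) (u N) (t + 1)).W k = 1 := by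
  have hQ0 := ne_zero_of_density hp hpos hQ
  have hprob := FeynmanKac.isProbabilityMeasure_Q hQ0
  have hQs := FeynmanKac.Q_succ hG₀ hGm hQ0
  refine weakLim_normalizeWeights
    (A := fun φ => ∫ z, (M.G (t + 1) z.1 z.2 : ℝ) * φ z.2 ∂(M.Q t ⊗ₘ M.m (t + 1))) ?_ ?_ ?_
  · rintro φ hφ ⟨C', hC'⟩
    have hψ : Continuous fun z : Cube d × Cube d => (M.G (t + 1) z.1 z.2 : ℝ) * φ z.2 :=
      (NNReal.continuous_coe.comp hG).mul (hφ.comp continuous_snd)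
    have key := tendsto_sum_resample_mutate hd hH hh hp hpos hQ hP hW hκ hF hu
      (ψ := fun z => (M.G (t + 1) z.2.1 z.2.2 : ℝ) * φ z.2.2) (hψ.comp continuous_snd)
      (C := C * C') (fun z => abs_mul_le_of_le (hC _ _) (hC' _))
    have hm : Measurable fun z : UI × Cube d => (toCube (H (inclUI z.1)), z.2) :=
      ((measurable_toCube_hilbert H).comp measurable_fst).prodMk measurable_snd
    rw [← map_compProd_hilbertKernel hh, integral_map hm.aemeasurable
      hψ.measurable.aestronglyMeasurable]
    exact key
  · simp only [mul_one]
    exact integral_weight_pos hG.measurable (f := Prod.snd) (hQs ▸ hQ')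
  · intro φ hφ
    rw [hQs, integral_reweighted hG.measurable measurable_snd hφ]
    simp only [mul_one]

end

theorem mainTheorem2 (d : ℕ) (hd : 1 ≤ d)
    (H : C(unitInterval, Fin d → unitInterval)) (hH : IsHilbertCurve H)
    (h : Cube d → UI) (hh : IsHilbertPseudoInverse H h)
    (T : ℕ) (M : FeynmanKac d)
    -- versions of the conditional distributions, i.e. of the Rosenblatt transforms
    (κ₀ : CondFamily d) (κ : ℕ → Cube d → CondFamily d)
    (hκ₀ : IsConditionalFamily M.m₀ κ₀)
    (hκ : ∀ t, 1 ≤ t → t ≤ T → ∀ x', IsConditionalFamily (M.m t x') (κ t x'))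
    -- the point sets
    (u₀ : (N : ℕ) → Fin N → Cube d) (u : (N : ℕ) → ℕ → Fin N → Cube (d + 1))
    (hu_sorted : ∀ N t, 1 ≤ t → t ≤ T → Monotone (fun n : Fin N => u N t n 0))
    (hu₀ : Tendsto (fun N => discrepancy (u₀ N)) atTop (𝓝 0))
    (hu : ∀ t, 1 ≤ t → t ≤ T → Tendsto (fun N => discrepancy (u N t)) atTop (𝓝 0))
    -- the particles are pairwise distinct
    (h_distinct : ∀ N t, t ≤ T →
      Function.Injective (sqmc M h κ₀ κ (u₀ N) (u N) t).x)
    -- the potentials are continuous and bounded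
    (hG₀ : Continuous M.G₀ ∧ ∃ C : ℝ≥0, ∀ x, M.G₀ x ≤ C)
    (hG : ∀ t, 1 ≤ t → t ≤ T →
      Continuous (fun p : Cube d × Cube d => M.G t p.1 p.2) ∧ ∃ C : ℝ≥0, ∀ x' x, M.G t x' x ≤ C)
    -- regularity of the Rosenblatt transforms
    (hF₀ : RosenblattRegular (fun _ : Cube d => κ₀))
    (hF : ∀ t, 1 ≤ t → t ≤ T → RosenblattRegular (κ t))
    -- the filtering distributions have strictly positive bounded densities
    (hQ : ∀ t, t ≤ T → ∃ p : Cube d → ℝ≥0, Measurable p ∧ (∀ x, 0 < p x) ∧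
      (∃ C : ℝ≥0, ∀ x, p x ≤ C) ∧
      M.Q t = (lebCube d).withDensity (fun x => (p x : ℝ≥0∞))) :
    (∀ t, t + 1 ≤ T →
      Tendsto (fun N : ℕ => extremeNorm
        (empirical (fun n : Fin N => joinPoint
          (h (sqmcHat M h κ₀ κ (u₀ N) (u N) t n), (sqmc M h κ₀ κ (u₀ N) (u N) (t + 1)).x n)))
        ((((M.Q t).map h) ⊗ₘ (hilbertKernel H (M.m (t + 1)))).map joinPoint))
        atTop (𝓝 0)) ∧
    (∀ t, t ≤ T →
      Tendsto (fun N : ℕ => extremeNorm (sqmc M h κ₀ κ (u₀ N) (u N) t).measure (M.Q t))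
        atTop (𝓝 0)) := by
  have hQ0 : ∀ t, t ≤ T → M.Q t ≠ 0 := fun t ht => by
    obtain ⟨p, hp, hpos, -, hQt⟩ := hQ t ht
    exact ne_zero_of_density hp hpos hQt
  -- Normalisation is carried along because the next resampling needs it. It holds only eventually:
  -- for small `N` all the potentials may vanish at the particles.
  have key : ∀ t, t ≤ T →
      WeakLim (fun N => (sqmc M h κ₀ κ (u₀ N) (u N) t).measure) (M.Q t) ∧
        ∀ᶠ N in atTop, ∑ k, (sqmc M h κ₀ κ (u₀ N) (u N) t).W k = 1 := by
    intro t
    induction t with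
    | zero =>
      intro ht
      obtain ⟨hG₀c, C, hC⟩ := hG₀
      exact weakLim_sqmc_zero hκ₀ hu₀ hG₀c hC hF₀ (hQ0 0 ht)
    | succ t ih =>
      intro ht
      obtain ⟨p, hp, hpos, -, hQt⟩ := hQ t (Nat.le_of_succ_le ht)
      obtain ⟨hP, hW⟩ := ih (Nat.le_of_succ_le ht)
      obtain ⟨hGc, C, hC⟩ := hG (t + 1) (Nat.le_add_left 1 t) ht
      exact weakLim_sqmc_succ hd hH hh (hκ _ (Nat.le_add_left 1 t) ht)
        (hu _ (Nat.le_add_left 1 t) ht) hG₀.1.measurable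
        (fun s h1 h2 => (hG s h1 (h2.trans ht)).1.measurable) hGc hC
        (hF _ (Nat.le_add_left 1 t) ht) hp hpos hQt (hQ0 _ ht) hP hW
  refine ⟨fun t ht => ?_, fun t ht => ?_⟩
  · obtain ⟨p, hp, hpos, -, hQt⟩ := hQ t (Nat.le_of_succ_le ht)
    have hprob := FeynmanKac.isProbabilityMeasure_Q (hQ0 t (Nat.le_of_succ_le ht))
    obtain ⟨hP, hW⟩ := key t (Nat.le_of_succ_le ht)
    have hκt := hκ _ (Nat.le_add_left 1 t) ht
    have hFt := hF _ (Nat.le_add_left 1 t) ht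
    have hreg := hH.isRegularLaw_map hd hh hp hpos hQt
    have hprobh := hreg.prob
    have hmk : IsMarkovKernel (hilbertKernel H (M.m (t + 1))) := by
      unfold hilbertKernel
      infer_instance
    have hJ : IsProbabilityMeasure ((((M.Q t).map h) ⊗ₘ
        (hilbertKernel H (M.m (t + 1)))).map joinPoint) :=
      Measure.isProbabilityMeasure_map continuous_joinPoint.measurable.aemeasurable
    refine WeakLim.tendsto_extremeNorm ?_ (map_joinPoint_hyperplane hreg hκt hFt)
    rintro φ hφ ⟨C, hC⟩
    -- The test function keeps the Hilbert index and the new particle and drops the resampled point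
    -- itself.
    have := tendsto_sum_resample_mutate hd hH hh hp hpos hQt hP hW hκt hFt
      (hu _ (Nat.le_add_left 1 t) ht) (ψ := fun z => φ (joinPoint (z.1, z.2.2)))
      (hφ.comp (continuous_joinPoint.comp
        (continuous_fst.prodMk (continuous_snd.comp continuous_snd)))) fun z => hC _
    rw [integral_map continuous_joinPoint.measurable.aemeasurable
      hφ.measurable.aestronglyMeasurable]
    simp_rw [integral_empirical]
    exact this
  · obtain ⟨p, hp, hpos, -, hQt⟩ := hQ t ht
    have hprob := FeynmanKac.isProbabilityMeasure_Q (hQ0 t ht)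
    refine (key t ht).1.tendsto_extremeNorm fun i r => ?_
    rw [hQt]
    exact withDensity_absolutelyContinuous _ _ (lebCube_hyperplane i r)
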